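/- Let $\ell\ge 2$ be an integer and let $W$ be a non-negative random variable with $E[W]=1$, $P[W=0]=0$ and $E[W^q]<+\infty$ for every real $q$. Let $(W_\varepsilon)$ be a family of independent copies of $W$ indexed by the finite words $\varepsilon$ over the alphabet $\{0,\dots,\ell-1\}$. For a word $\varepsilon_1\cdots\varepsilon_n$ let $$I_{\varepsilon_1\cdots\varepsilon_n}=\Big[\sum_{k=1}^n\frac{\varepsilon_k}{\ell^k},\ \sum_{k=1}^n\frac{\varepsilon_k}{\ell^k}+\frac1{\ell^n}\Big),$$ and for $x\in[0,1)$ let $I_n(x)$ be the unique interval of this form, with a word of length $n$, that contains $x$. Let $$m_n=f_n\lambda,\qquad f_n=\sum_{\varepsilon_1\cdots\varepsilon_n}W_{\varepsilon_1}W_{\varepsilon_1\varepsilon_2}\cdots W_{\varepsilon_1\cdots\varepsilon_n}\,\mathbf 1_{I_{\varepsilon_1\cdots\varepsilon_n}},$$ where $\lambda$ is the Lebesgue measure on $[0,1]$, and let the Mandelbrot cascade $m$ be the weak limit of $(m_n)$, which exists almost surely. Assume that $m$ is non-degenerate, i.e. $P[m([0,1])\neq 0]>0$. Put $\tau(q)=\log_\ell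 E[W^q]-(q-1)$ for $q\in\mathbb R$ (a differentiable function), $\tau^*(\beta)=\inf_{t\in\mathbb R}(t\beta+\tau(t))$, and let $(q_{\min},q_{\max})$ be the open interval $\{q\in\mathbb R : \tau^*(-\tau'(q))>0\}$. Let $q\in(q_{\min},q_{\max})$ and $\beta=-\tau'(q)$. Then, almost surely, $$\dim(E_\beta)\ \ge\ \tau^*(\beta),\qquad E_\beta=\Big\{x\in[0,1)\ :\ \lim_{n\to\infty}\frac{\log m(I_n(x))}{\log|I_n(x)|}=\beta\Big\},$$ where $\dim$ is the Hausdorff dimension and $|I|$ is the length of $I$. -/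

import Mathlib

open MeasureTheory ProbabilityTheory Filter Topology

noncomputable section

namespace Mandelbrot

/-- The `ℓ`-adic interval `I_ε = [∑ ε_k / ℓ^k, ∑ ε_k / ℓ^k + 1 / ℓ^n)` of the `n`-th generation
attached to the word `ε = ε_1 ⋯ ε_n` (the letter `ε_k` is `ε (k - 1)`). -/
def adicInterval {ℓ n : ℕ} (ε : Fin n → Fin ℓ) : Set ℝ :=
  Set.Ico (∑ k : Fin n, ((ε k : ℕ) : ℝ) / (ℓ : ℝ) ^ ((k : ℕ) + 1))
    ((∑ k : Fin n, ((ε k : ℕ) : ℝ) / (ℓ : ℝ) ^ ((k : ℕ) + 1)) + 1 / (ℓ : ℝ) ^ n)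

/-- `I_n(x)`: the `ℓ`-adic interval of the `n`-th generation that contains `x ∈ [0, 1)`
(written as the union of all intervals of that generation containing `x`; there is
exactly one). -/
def adicIntervalAt (ℓ n : ℕ) (x : ℝ) : Set ℝ :=
  ⋃ (ε : Fin n → Fin ℓ) (_ : x ∈ adicInterval ε), adicInterval ε

/-- The density `f_n = ∑_{ε_1 ⋯ ε_n} W_{ε_1} W_{ε_1 ε_2} ⋯ W_{ε_1 ⋯ ε_n} 1_{I_{ε_1 ⋯ ε_n}}`. -/
def density {ℓ : ℕ} {Ω : Type*} (W : List (Fin ℓ) → Ω → ℝ) (n : ℕ) (ω : Ω) (x : ℝ) : ℝ :=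
  ∑ ε : Fin n → Fin ℓ,
    (adicInterval ε).indicator
      (fun _ => ∏ k : Fin n, W ((List.ofFn ε).take ((k : ℕ) + 1)) ω) x

/-- The measure `f_n λ`, where `λ` is the Lebesgue measure on `[0, 1]`. -/
def approxMeasure {ℓ : ℕ} {Ω : Type*} (W : List (Fin ℓ) → Ω → ℝ) (n : ℕ) (ω : Ω) : Measure ℝ :=
  (volume.restrict (Set.Icc 0 1)).withDensity (fun x => ENNReal.ofReal (density W n ω x))

theorem isFiniteMeasure_approxMeasure {ℓ : ℕ} {Ω : Type*} (W : List (Fin ℓ) → Ω → ℝ) (n : ℕ)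
    (ω : Ω) : IsFiniteMeasure (approxMeasure W n ω) := by
  refine isFiniteMeasure_withDensity_ofReal (Integrable.hasFiniteIntegral ?_)
  unfold density
  refine integrable_finsetSum _ fun ε _ => ?_
  exact (integrable_const _).indicator measurableSet_Ico

/-- The random measure `m_n = f_n λ`, as an element of the space of finite measures endowed with
the topology of weak convergence. -/
def approx {ℓ : ℕ} {Ω : Type*} (W : List (Fin ℓ) → Ω → ℝ) (n : ℕ) (ω : Ω) : FiniteMeasure ℝ :=
  ⟨approxMeasure W n ω, isFiniteMeasure_approxMeasure W n ω⟩

/-- The Mandelbrot cascade built from the family `W`: the weak limit `m` of `m_n`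
(an arbitrary value at those `ω` where there is no limit). -/
def cascade {ℓ : ℕ} {Ω : Type*} (W : List (Fin ℓ) → Ω → ℝ) (ω : Ω) : FiniteMeasure ℝ :=
  limUnder atTop (fun n => approx W n ω)

/-- The structure function `τ(q) = log_ℓ E[W^q] - (q - 1)` of a weight `W` with `P[W = 0] = 0`. -/
def structureFn (ℓ : ℕ) {Ω₀ : Type*} [MeasurableSpace Ω₀] (P₀ : Measure Ω₀) (W₀ : Ω₀ → ℝ)
    (q : ℝ) : ℝ :=
  Real.logb ℓ (∫ ω, W₀ ω ^ q ∂P₀) - (q - 1)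

/-- The Legendre transform `τ^*(β) = inf_{t ∈ ℝ} (t β + τ(t))`, with values in `[-∞, ∞]`. -/
def legendre (τ : ℝ → ℝ) (β : ℝ) : EReal :=
  ⨅ t : ℝ, ((t * β + τ t : ℝ) : EReal)

/-- The interval `(q_min, q_max) = {q ∈ ℝ ; τ^*(-τ'(q)) > 0}`. -/
def qInterval (τ : ℝ → ℝ) : Set ℝ :=
  {q : ℝ | 0 < legendre τ (-deriv τ q)}

/-- The level set `E_β` of the points `x ∈ [0, 1)` such that
`log m(I_n(x)) / log |I_n(x)| → β` (`β` real). If `m(I_n(x)) = 0` for some `n`, then the quotient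
is `+∞` from that `n` on, and `x` is not in `E_β`; `Real.log 0 = 0` makes it necessary to say so. -/
def levelSet (ℓ : ℕ) (m : Measure ℝ) (β : ℝ) : Set ℝ :=
  {x : ℝ | x ∈ Set.Ico (0 : ℝ) 1 ∧ (∀ n : ℕ, m (adicIntervalAt ℓ n x) ≠ 0) ∧
    Tendsto (fun n : ℕ => Real.log (m.real (adicIntervalAt ℓ n x)) /
      Real.log (volume.real (adicIntervalAt ℓ n x))) atTop (𝓝 β)}

end Mandelbrot

end

/-!
# The Hausdorff dimension of the level sets of a Mandelbrot cascade

The lower bound comes from an auxiliary measure carried by the level set. Given `q`, tilt the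
weights: the cascade `N` built from the weights `W ^ q / E[W ^ q]`, on the same tree as `m`, gives
full mass to the points of local `m`-dimension `β = -τ'(q)`, and has itself local dimension at least
`q β + τ(q)`. The mass distribution principle then bounds the dimension of the level set from below
by `q β + τ(q)`, and this number is at least `τ^*(β)`, by definition of the infimum.

The labels of the tree are the values of `log W`, with law `ν`; if `Λ` is the cumulant generating
function of `ν`, then `τ(t) = Λ(t) / log ℓ - (t - 1)`, and the cascade tilted by `t` has edge
weights `exp (t x - Λ(t)) / ℓ` (`tilt`). Thus `m` and `N` are the cases `t = 1` and `t = q`.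

Both properties of `N` follow from one first-moment computation. For a cell `I`, its `N`-mass is a
product of independent weights times the limit mass of an independent subtree, and likewise for the
cascade tilted by `t`. Hence the mean of the sum of `N(I) (m_t(I) / |I| ^ c) ^ s` over the cells of
the generation `n` is a constant times `exp (n * rate)`, where the rate vanishes at `s = 0` and has
there the derivative `(c - 1) log ℓ + t Λ'(q) - Λ(t)`. If this derivative is not zero, small `s` of
the appropriate sign make the rate negative, so that the sum over all cells is almost surely finite
(`ae_tsum_cellMass_ne_top`), and, by the Borel-Cantelli argument of `ae_eventually_rpow_le_one`, the
ratio `m_t(I) / |I| ^ c` stays eventually below one, or above one, at `N`-almost every point. With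
`t = 1` and `c` close to `β` on either side this identifies the local dimension of `m`; with `t = q`
and `c < q β + τ(q)` it bounds that of `N`.

The constant has to be finite, and `N` has to be nonzero.
* The hypothesis `τ^*(β) > 0` gives `q β + τ(q) > 0`, which is the condition for
  `ℓ E[tilt ^ (1 + s)] < 1` for some small `s > 0`. The total mass of the tilted cascade is then a
  martingale bounded in `L^(1 + s)` (`exists_lintegral_genMass_rpow_le`), and its limit is not
  almost surely zero (`not_ae_limMass_eq_zero`). By the zero-one law `ae_limMass_ne_zero`, the limit
  masses are almost surely positive.
* The limit masses have a finite moment of some negative order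
  (`exists_lintegral_limMass_rpow_neg_ne_top`), because a small limit mass forces two independent
  branches to be small. With the moment of order `1 + s` of `N` this bounds the mixed moments that
  enter the constant (`exists_forall_lintegral_mul_rpow_ne_top`).

Finally, the weak limit exists whenever the total masses of all subtrees converge, and the mass of
a half-open cell is the product predicted by the tree (`limMeasure_cell`), since almost surely the
limit measures do not charge the end points of the cells.
-/

noncomputable section

open scoped ENNReal NNReal

namespace CascadeTree

/-! ### Masses on a labelled tree -/

section

variable {ℓ : ℕ}

/-- A labelled `ℓ`-ary tree: the value at `(i, v)` is the label of the edge that leads to the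
word `i :: v`. Indexing by pairs, and not by all words, leaves the root without a label, so that the
labels of distinct subtrees, and those of the edges leading to them, are disjoint families of
coordinates. -/
abbrev Tree (ℓ : ℕ) : Type := Fin ℓ × List (Fin ℓ) → ℝ

/-- The subtree hanging at the child `i` of the root. -/
def subTree (i : Fin ℓ) (a : Tree ℓ) : Tree ℓ := fun p => a (i, p.1 :: p.2)

/-- The subtree hanging at the word `w`. -/
def subTreeAt : List (Fin ℓ) → Tree ℓ → Tree ℓ
  | [], a => a
  | i :: w, a => subTreeAt w (subTree i a)

/-- The product of the weights `g` of the edges on the path from the root to the word `w`. -/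
def pathWeight (g : ℝ → ℝ≥0) : List (Fin ℓ) → Tree ℓ → ℝ≥0
  | [], _ => 1
  | i :: w, a => g (a (i, [])) * pathWeight g w (subTree i a)

/-- The total mass of the `n`-th generation of the cascade with edge weights `g`. The factor
`1 / ℓ` of a cascade is part of `g`. -/
def genMass (g : ℝ → ℝ≥0) : ℕ → Tree ℓ → ℝ≥0
  | 0, _ => 1
  | n + 1, a => ∑ i, g (a (i, [])) * genMass g n (subTree i a)

/-- The limit total mass of the cascade, taken as a lower limit so that it is defined, and
measurable, for every tree. -/
def limMass (g : ℝ → ℝ≥0) (a : Tree ℓ) : ℝ≥0∞ :=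
  liminf (fun n => (genMass g n a : ℝ≥0∞)) atTop

/-- The mass given by the limit cascade to the cell of the word `w`. -/
def cellMass (g : ℝ → ℝ≥0) (w : List (Fin ℓ)) (a : Tree ℓ) : ℝ≥0∞ :=
  pathWeight g w a * limMass g (subTreeAt w a)

/-- The coordinate of a tree that the subtree at `w` reads at `p`. -/
def position : List (Fin ℓ) → Fin ℓ × List (Fin ℓ) → Fin ℓ × List (Fin ℓ)
  | [], p => p
  | i :: w, p => (i, (position w p).1 :: (position w p).2)

theorem subTreeAt_apply (w : List (Fin ℓ)) (a : Tree ℓ) (p : Fin ℓ × List (Fin ℓ)) :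
    subTreeAt w a p = a (position w p) := by
  induction w generalizing a with
  | nil => rfl
  | cons i w ih => exact ih _

theorem length_position (w : List (Fin ℓ)) (p : Fin ℓ × List (Fin ℓ)) :
    (position w p).2.length = w.length + p.2.length := by
  induction w with
  | nil => simp [position]
  | cons i w ih => simp [position, ih]; omega

@[fun_prop]
theorem measurable_subTree (i : Fin ℓ) : Measurable (subTree i) := by
  unfold subTree; fun_prop

@[fun_prop]
theorem measurable_subTreeAt (w : List (Fin ℓ)) : Measurable (subTreeAt w) := by
  induction w with
  | nil => exact measurable_id
  | cons i w ih => exact ih.comp (measurable_subTree i)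

variable {g : ℝ → ℝ≥0}

theorem measurable_pathWeight (hg : Measurable g) (w : List (Fin ℓ)) :
    Measurable (pathWeight g w) := by
  induction w with
  | nil => exact measurable_const
  | cons i w ih =>
    have := ih.comp (measurable_subTree i)
    exact (hg.comp (measurable_pi_apply _)).mul this

theorem measurable_genMass (hg : Measurable g) (n : ℕ) :
    Measurable (genMass (ℓ := ℓ) g n) := by
  induction n with
  | zero => exact measurable_const
  | succ n ih =>
    refine Finset.measurable_fun_sum _ fun i _ => ?_
    exact (hg.comp (measurable_pi_apply _)).mul (ih.comp (measurable_subTree i))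

theorem measurable_limMass (hg : Measurable g) : Measurable (limMass (ℓ := ℓ) g) :=
  Measurable.liminf fun n => (measurable_genMass hg n).coe_nnreal_ennreal

theorem measurable_cellMass (hg : Measurable g) (w : List (Fin ℓ)) :
    Measurable (cellMass (ℓ := ℓ) g w) :=
  (measurable_pathWeight hg w).coe_nnreal_ennreal.mul
    ((measurable_limMass hg).comp (measurable_subTreeAt w))

theorem cellMass_nil (a : Tree ℓ) : cellMass g [] a = limMass g a := by
  simp [cellMass, pathWeight, subTreeAt]

theorem cellMass_cons (i : Fin ℓ) (w : List (Fin ℓ)) (a : Tree ℓ) :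
    cellMass g (i :: w) a = g (a (i, [])) * cellMass g w (subTree i a) := by
  simp [cellMass, pathWeight, subTreeAt, mul_assoc]

theorem sum_cons {A : Type*} [AddCommMonoid A] (n : ℕ) (f : (Fin (n + 1) → Fin ℓ) → A) :
    ∑ w, f w = ∑ i : Fin ℓ, ∑ w : Fin n → Fin ℓ, f (Fin.cons i w) := by
  rw [← Fintype.sum_prod_type', ← (Fin.consEquiv fun _ => Fin ℓ).sum_comp]
  rfl

theorem sum_words_succ {A : Type*} [AddCommMonoid A] (n : ℕ) (f : List (Fin ℓ) → A) :
    ∑ w : Fin (n + 1) → Fin ℓ, f (List.ofFn w) =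
      ∑ i : Fin ℓ, ∑ w : Fin n → Fin ℓ, f (i :: List.ofFn w) := by
  simp only [sum_cons, List.ofFn_cons]

theorem genMass_add (n k : ℕ) (a : Tree ℓ) :
    genMass g (n + k) a = ∑ w : Fin n → Fin ℓ,
      pathWeight g (List.ofFn w) a * genMass g k (subTreeAt (List.ofFn w) a) := by
  induction n generalizing a with
  | zero => simp [pathWeight, subTreeAt]
  | succ n ih =>
    rw [sum_words_succ n (fun w => pathWeight g w a * genMass g k (subTreeAt w a)),
      Nat.add_right_comm, genMass]
    refine Finset.sum_congr rfl fun i _ => ?_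
    rw [ih, Finset.mul_sum]
    simp only [pathWeight, subTreeAt, mul_assoc]

theorem mul_limMass_subTree_le (i : Fin ℓ) (a : Tree ℓ) :
    g (a (i, [])) * limMass g (subTree i a) ≤ limMass g a := by
  have h : limMass g a = liminf (fun n => (genMass g (n + 1) a : ℝ≥0∞)) atTop :=
    (liminf_nat_add (fun n => (genMass g n a : ℝ≥0∞)) 1).symm
  rw [h, limMass, ← ENNReal.liminf_const_mul_of_ne_top ENNReal.coe_ne_top]
  refine liminf_le_liminf (Eventually.of_forall fun n => ?_)
  rw [genMass]
  push_cast
  exact Finset.single_le_sum (f := fun j => (g (a (j, [])) : ℝ≥0∞) * genMass g n (subTree j a))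
    (fun _ _ => zero_le) (Finset.mem_univ i)

/-! ### Independence in the random tree -/

/-- The law of a tree whose labels are independent with law `ν`. -/
def treeLaw (ℓ : ℕ) (ν : Measure ℝ) : Measure (Tree ℓ) := Measure.infinitePi fun _ => ν

/-- The `σ`-algebra generated by the labels at the positions in `S`. -/
@[reducible]
def coordAlgebra (S : Set (Fin ℓ × List (Fin ℓ))) : MeasurableSpace (Tree ℓ) :=
  ⨆ k ∈ S, MeasurableSpace.comap (fun a : Tree ℓ => a k) inferInstance

theorem coordAlgebra_le (S : Set (Fin ℓ × List (Fin ℓ))) :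
    coordAlgebra S ≤ (inferInstance : MeasurableSpace (Tree ℓ)) :=
  iSup₂_le fun k _ => (measurable_pi_apply k).comap_le

theorem coordAlgebra_mono {S T : Set (Fin ℓ × List (Fin ℓ))} (h : S ⊆ T) :
    coordAlgebra S ≤ coordAlgebra T :=
  iSup₂_le fun k hk => le_iSup₂_of_le k (h hk) le_rfl

theorem measurable_coord {S : Set (Fin ℓ × List (Fin ℓ))} {k : Fin ℓ × List (Fin ℓ)}
    (hk : k ∈ S) : Measurable[coordAlgebra S] fun a : Tree ℓ => a k := by
  have h : MeasurableSpace.comap (fun a : Tree ℓ => a k) inferInstance ≤ coordAlgebra S :=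
    le_iSup₂_of_le k hk le_rfl
  exact (comap_measurable _).mono h le_rfl

theorem measurable_pathWeight_coordAlgebra (hg : Measurable g) {n : ℕ} (w : List (Fin ℓ))
    (hw : w.length = n) :
    Measurable[coordAlgebra {k | k.2.length < n}] (pathWeight (ℓ := ℓ) g w) := by
  subst hw
  -- generalise to a map into trees, so that the induction can pass to a subtree
  have key : ∀ (w : List (Fin ℓ)) (m : MeasurableSpace (Tree ℓ)) (f : Tree ℓ → Tree ℓ),
      (∀ k, k.2.length < w.length → Measurable[m] fun a => f a k) →
      Measurable[m] fun a => pathWeight g w (f a) := by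
    intro w
    induction w with
    | nil => exact fun m f _ => measurable_const
    | cons i w ih =>
      intro m f hf
      refine Measurable.mul (hg.comp (hf (i, []) (by simp))) (ih m (fun a => subTree i (f a)) ?_)
      intro k hk
      exact hf (i, k.1 :: k.2) (by simpa using hk)
  exact key w _ id fun k hk => measurable_coord hk

theorem measurable_subTreeAt_coord {n : ℕ} (w : List (Fin ℓ)) (hw : w.length = n) (i : Fin ℓ) :
    Measurable[coordAlgebra {k | k.2.length = n}]
      fun a : Tree ℓ => subTreeAt w a (i, []) := by
  simp only [subTreeAt_apply]
  exact measurable_coord (by simp [length_position, hw])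

theorem measurable_subTree_coordAlgebra (i : Fin ℓ) :
    Measurable[coordAlgebra {k | k.1 = i ∧ k.2 ≠ []}] (subTree (ℓ := ℓ) i) :=
  (@measurable_pi_iff _ _ _ (coordAlgebra {k | k.1 = i ∧ k.2 ≠ []}) _ _).2
    fun p => measurable_coord (by simp)

variable {ν : Measure ℝ} [IsProbabilityMeasure ν]

instance : IsProbabilityMeasure (treeLaw ℓ ν) := by unfold treeLaw; infer_instance

theorem lintegral_mul_of_disjoint {S T : Set (Fin ℓ × List (Fin ℓ))} (hST : Disjoint S T)
    {f h : Tree ℓ → ℝ≥0∞} (hf : Measurable[coordAlgebra S] f) (hh : Measurable[coordAlgebra T] h) :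
    ∫⁻ a, f a * h a ∂treeLaw ℓ ν = (∫⁻ a, f a ∂treeLaw ℓ ν) * ∫⁻ a, h a ∂treeLaw ℓ ν := by
  refine lintegral_mul_eq_lintegral_mul_lintegral_of_independent_measurableSpace
    (coordAlgebra_le S) (coordAlgebra_le T) ?_ hf hh
  refine indep_iSup_of_disjoint (fun k => (measurable_pi_apply k).comap_le) ?_ hST
  exact iIndepFun_infinitePi (P := fun _ : Fin ℓ × List (Fin ℓ) => ν) (X := fun _ x => x)
    (fun _ => measurable_id)

theorem map_coord (k : Fin ℓ × List (Fin ℓ)) : (treeLaw ℓ ν).map (fun a => a k) = ν :=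
  Measure.infinitePi_map_eval _ _

theorem measurePreserving_subTree (i : Fin ℓ) :
    MeasurePreserving (subTree i) (treeLaw ℓ ν) (treeLaw ℓ ν) := by
  refine ⟨measurable_subTree i, ?_⟩
  refine Measure.map_infinitePi_infinitePi_of_inj (P := fun _ : Fin ℓ × List (Fin ℓ) => ν)
    (f := fun p : Fin ℓ × List (Fin ℓ) => (i, p.1 :: p.2)) ?_
  rintro ⟨j, v⟩ ⟨j', v'⟩ h
  simpa using h

theorem measurePreserving_subTreeAt (w : List (Fin ℓ)) :
    MeasurePreserving (subTreeAt w) (treeLaw ℓ ν) (treeLaw ℓ ν) := by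
  induction w with
  | nil => exact MeasurePreserving.id _
  | cons i w ih => exact ih.comp (measurePreserving_subTree i)

/-- A property that holds for almost every tree holds for almost every tree together with all its
subtrees. -/
theorem ae_forall_subTreeAt {p : Tree ℓ → Prop} (h : ∀ᵐ a ∂treeLaw ℓ ν, p a) :
    ∀ᵐ a ∂treeLaw ℓ ν, ∀ w, p (subTreeAt w a) :=
  ae_all_iff.2 fun w => (measurePreserving_subTreeAt w).quasiMeasurePreserving.ae h

theorem lintegral_coord (k : Fin ℓ × List (Fin ℓ)) {f : ℝ → ℝ≥0∞} (hf : Measurable f) :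
    ∫⁻ a, f (a k) ∂treeLaw ℓ ν = ∫⁻ x, f x ∂ν := by
  conv_rhs => rw [← map_coord (ℓ := ℓ) (ν := ν) k, lintegral_map hf (measurable_pi_apply k)]

theorem lintegral_coord_mul_subTree (i : Fin ℓ) {f : ℝ → ℝ≥0∞} (hf : Measurable f)
    {F : Tree ℓ → ℝ≥0∞} (hF : Measurable F) :
    ∫⁻ a, f (a (i, [])) * F (subTree i a) ∂treeLaw ℓ ν
      = (∫⁻ x, f x ∂ν) * ∫⁻ a, F a ∂treeLaw ℓ ν := by
  rw [lintegral_mul_of_disjoint (S := {(i, [])}) (T := {k | k.1 = i ∧ k.2 ≠ []})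
    (f := fun a => f (a (i, []))) (h := fun a => F (subTree i a)) (by simp)
    (hf.comp (measurable_coord rfl)) (hF.comp (measurable_subTree_coordAlgebra i)),
    lintegral_coord _ hf, (measurePreserving_subTree i).lintegral_comp hF]

theorem measurable_branch (i : Fin ℓ) {F : ℝ × Tree ℓ → ℝ≥0∞} (hF : Measurable F) :
    Measurable[coordAlgebra {k | k.1 = i}] fun a : Tree ℓ => F (a (i, []), subTree i a) := by
  have h : coordAlgebra {k : Fin ℓ × List (Fin ℓ) | k.1 = i ∧ k.2 ≠ []}
      ≤ coordAlgebra {k | k.1 = i} := coordAlgebra_mono fun k hk => hk.1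
  exact hF.comp (Measurable.prodMk (measurable_coord rfl)
    ((measurable_subTree_coordAlgebra i).mono h le_rfl))

theorem lintegral_branch_mul_branch {i j : Fin ℓ} (hij : i ≠ j) {F G : ℝ × Tree ℓ → ℝ≥0∞}
    (hF : Measurable F) (hG : Measurable G) :
    ∫⁻ a, F (a (i, []), subTree i a) * G (a (j, []), subTree j a) ∂treeLaw ℓ ν
      = (∫⁻ a, F (a (i, []), subTree i a) ∂treeLaw ℓ ν)
        * ∫⁻ a, G (a (j, []), subTree j a) ∂treeLaw ℓ ν := by
  refine lintegral_mul_of_disjoint (S := {k | k.1 = i}) (T := {k | k.1 = j}) ?_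
    (measurable_branch i hF) (measurable_branch j hG)
  rw [Set.disjoint_left]
  rintro k rfl hk
  exact hij hk

theorem lintegral_pathWeight_mul (hg : Measurable g) (w : List (Fin ℓ))
    {F : Tree ℓ → ℝ≥0∞} (hF : Measurable F) :
    ∫⁻ a, pathWeight g w a * F (subTreeAt w a) ∂treeLaw ℓ ν
      = (∫⁻ x, g x ∂ν) ^ w.length * ∫⁻ a, F a ∂treeLaw ℓ ν := by
  induction w with
  | nil => simp [pathWeight, subTreeAt]
  | cons i w ih =>
    have := lintegral_coord_mul_subTree (ν := ν) i (f := fun x => (g x : ℝ≥0∞))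
      hg.coe_nnreal_ennreal (F := fun a => pathWeight g w a * F (subTreeAt w a))
      ((measurable_pathWeight hg w).coe_nnreal_ennreal.mul (hF.comp (measurable_subTreeAt w)))
    rw [ih] at this
    simp only [pathWeight, subTreeAt, ENNReal.coe_mul, mul_assoc, List.length_cons, pow_succ']
    exact this

end

/-! ### Convergence of the total mass -/

section

variable {ℓ : ℕ} {g : ℝ → ℝ≥0} {ν : Measure ℝ} [IsProbabilityMeasure ν]

theorem lintegral_genMass (hg : Measurable g) (hcrit : (ℓ : ℝ≥0∞) * ∫⁻ x, g x ∂ν = 1) (n : ℕ) :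
    ∫⁻ a, genMass g n a ∂treeLaw ℓ ν = 1 := by
  induction n with
  | zero => simp [genMass]
  | succ n ih =>
    simp only [genMass, ENNReal.ofNNReal_finsetSum, ENNReal.coe_mul]
    rw [lintegral_finsetSum]
    · simp_rw [lintegral_coord_mul_subTree _ hg.coe_nnreal_ennreal
        (measurable_genMass hg n).coe_nnreal_ennreal, ih]
      simpa using hcrit
    · exact fun i _ => (hg.comp (measurable_pi_apply _)).coe_nnreal_ennreal.mul
        ((measurable_genMass hg n).comp (measurable_subTree i)).coe_nnreal_ennreal

theorem measurable_genMass_coordAlgebra (hg : Measurable g) (n : ℕ) :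
    Measurable[coordAlgebra {k | k.2.length < n}] (genMass (ℓ := ℓ) g n) := by
  have h : genMass (ℓ := ℓ) g n = fun a => ∑ w : Fin n → Fin ℓ, pathWeight g (List.ofFn w) a := by
    funext a
    simpa [genMass] using genMass_add n 0 a
  rw [h]
  refine Finset.measurable_fun_sum _ fun w _ => ?_
  exact measurable_pathWeight_coordAlgebra hg _ (List.length_ofFn)

/-- The martingale property of the total mass, in the form of an equality of integrals: the
weights of the generation `n + 1` are independent of the past and have total mean one. -/
theorem setLIntegral_genMass_succ (hg : Measurable g)
    (hcrit : (ℓ : ℝ≥0∞) * ∫⁻ x, g x ∂ν = 1) (n : ℕ) {s : Set (Tree ℓ)}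
    (hs : MeasurableSet[coordAlgebra {k | k.2.length < n}] s) :
    ∫⁻ a in s, genMass g (n + 1) a ∂treeLaw ℓ ν = ∫⁻ a in s, genMass g n a ∂treeLaw ℓ ν := by
  have hs' : MeasurableSet s := coordAlgebra_le _ _ hs
  have hw : ∀ w : Fin n → Fin ℓ,
      Measurable[coordAlgebra {k : Fin ℓ × List (Fin ℓ) | k.2.length < n}]
        (s.indicator fun a => (pathWeight g (List.ofFn w) a : ℝ≥0∞)) := fun w => by
    have := measurable_pathWeight_coordAlgebra hg (List.ofFn w) List.length_ofFn
    exact Measurable.indicator this.coe_nnreal_ennreal hs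
  have key : ∀ w : Fin n → Fin ℓ,
      ∫⁻ a in s, (pathWeight g (List.ofFn w) a *
          genMass g 1 (subTreeAt (List.ofFn w) a) : ℝ≥0) ∂treeLaw ℓ ν
        = ∫⁻ a in s, pathWeight g (List.ofFn w) a ∂treeLaw ℓ ν := by
    intro w
    rw [← lintegral_indicator hs', ← lintegral_indicator hs']
    have h1 : ∀ a, s.indicator (fun a => ((pathWeight g (List.ofFn w) a *
          genMass g 1 (subTreeAt (List.ofFn w) a) : ℝ≥0) : ℝ≥0∞)) a
        = ∑ i, s.indicator (fun a => (pathWeight g (List.ofFn w) a : ℝ≥0∞)) a *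
            g (subTreeAt (List.ofFn w) a (i, [])) := by
      intro a
      by_cases ha : a ∈ s <;> simp [ha, genMass, Finset.mul_sum]
    have hm : ∀ i, Measurable[coordAlgebra {k : Fin ℓ × List (Fin ℓ) | k.2.length = n}]
        fun a : Tree ℓ => (g (subTreeAt (List.ofFn w) a (i, [])) : ℝ≥0∞) := fun i => by
      have := measurable_subTreeAt_coord (List.ofFn w) List.length_ofFn i
      exact hg.coe_nnreal_ennreal.comp this
    simp_rw [h1]
    rw [lintegral_finsetSum]
    · have : ∀ i : Fin ℓ, ∫⁻ a, s.indicator (fun a => (pathWeight g (List.ofFn w) a : ℝ≥0∞)) a *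
            g (subTreeAt (List.ofFn w) a (i, [])) ∂treeLaw ℓ ν
          = (∫⁻ a, s.indicator (fun a => (pathWeight g (List.ofFn w) a : ℝ≥0∞)) a ∂treeLaw ℓ ν)
            * ∫⁻ x, g x ∂ν := fun i => by
        rw [lintegral_mul_of_disjoint (S := {k | k.2.length < n}) (T := {k | k.2.length = n})
          ?_ (hw w) (hm i)]
        · simp only [subTreeAt_apply]
          rw [lintegral_coord _ hg.coe_nnreal_ennreal]
        · rw [Set.disjoint_left]
          intro k hk hk'
          exact (ne_of_lt hk) hk'
      simp_rw [this]
      rw [Finset.sum_const, Finset.card_univ, Fintype.card_fin, nsmul_eq_mul, mul_left_comm, hcrit,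
        mul_one]
    · exact fun i _ => ((hw w).mono (coordAlgebra_le _) le_rfl).mul
        ((hm i).mono (coordAlgebra_le _) le_rfl)
  have hn : ∀ a : Tree ℓ, genMass g n a = ∑ w : Fin n → Fin ℓ, pathWeight g (List.ofFn w) a :=
    fun a => by simpa [genMass] using genMass_add n 0 a
  simp_rw [genMass_add n 1, hn, ENNReal.ofNNReal_finsetSum]
  rw [lintegral_finsetSum, lintegral_finsetSum]
  · exact Finset.sum_congr rfl fun w _ => key w
  · exact fun w _ => (measurable_pathWeight hg _).coe_nnreal_ennreal
  · exact fun w _ => ((measurable_pathWeight hg _).mul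
      ((measurable_genMass hg 1).comp (measurable_subTreeAt _))).coe_nnreal_ennreal

/-- The filtration of the generations. -/
def generation (ℓ : ℕ) : Filtration ℕ (inferInstance : MeasurableSpace (Tree ℓ)) where
  seq n := coordAlgebra {k | k.2.length < n}
  mono' _ _ h := coordAlgebra_mono fun _ hk => lt_of_lt_of_le hk h
  le' _ := coordAlgebra_le _

theorem martingale_genMass (hg : Measurable g) (hcrit : (ℓ : ℝ≥0∞) * ∫⁻ x, g x ∂ν = 1) :
    Martingale (fun n (a : Tree ℓ) => (genMass g n a : ℝ)) (generation ℓ) (treeLaw ℓ ν) := by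
  have hm : ∀ n, Measurable fun a : Tree ℓ => (genMass g n a : ℝ) := fun n =>
    (measurable_genMass hg n).coe_nnreal_real
  refine martingale_of_setIntegral_eq_succ (fun n => ?_) (fun n => ?_) fun n s hs => ?_
  · exact (measurable_genMass_coordAlgebra hg n).coe_nnreal_real.stronglyMeasurable
  · refine ⟨(hm n).aestronglyMeasurable, ?_⟩
    simp [HasFiniteIntegral, lintegral_genMass hg hcrit n]
  · rw [integral_eq_lintegral_of_nonneg_ae (ae_of_all _ fun a => NNReal.coe_nonneg _)
      (hm n).aestronglyMeasurable, integral_eq_lintegral_of_nonneg_ae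
      (ae_of_all _ fun a => NNReal.coe_nonneg _) (hm (n + 1)).aestronglyMeasurable]
    simp_rw [ENNReal.ofReal_coe_nnreal]
    rw [setLIntegral_genMass_succ hg hcrit n hs]

theorem ae_tendsto_genMass (hg : Measurable g) (hcrit : (ℓ : ℝ≥0∞) * ∫⁻ x, g x ∂ν = 1) :
    ∀ᵐ a ∂treeLaw ℓ ν, ∃ c : ℝ≥0, Tendsto (fun n => genMass g n a) atTop (𝓝 c) := by
  have h := (martingale_genMass hg hcrit).submartingale.exists_ae_tendsto_of_bdd (R := 1)
    fun n => by
      rw [eLpNorm_one_eq_lintegral_enorm]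
      simp [lintegral_genMass hg hcrit n]
  filter_upwards [h] with a ⟨c, hc⟩
  have hc0 : 0 ≤ c := ge_of_tendsto' hc fun n => NNReal.coe_nonneg _
  exact ⟨⟨c, hc0⟩, NNReal.tendsto_coe.1 hc⟩

theorem limMass_eq_of_tendsto {a : Tree ℓ} {c : ℝ≥0}
    (h : Tendsto (fun n => genMass g n a) atTop (𝓝 c)) : limMass g a = c :=
  (ENNReal.tendsto_coe.2 h).liminf_eq

theorem lintegral_limMass_le_one (hg : Measurable g)
    (hcrit : (ℓ : ℝ≥0∞) * ∫⁻ x, g x ∂ν = 1) : ∫⁻ a, limMass g a ∂treeLaw ℓ ν ≤ 1 := by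
  refine (lintegral_liminf_le fun n => (measurable_genMass hg n).coe_nnreal_ennreal).trans ?_
  simp [lintegral_genMass hg hcrit]

/-! ### The zero-one law -/

/-- If the limit mass vanishes, it vanishes on two independent subtrees, so that the probability
`p` of this event satisfies `p ≤ p ^ 2`. -/
theorem ae_limMass_ne_zero (hℓ : 2 ≤ ℓ) (hg : Measurable g) (hg0 : ∀ x, g x ≠ 0)
    (h : ¬ ∀ᵐ a ∂treeLaw ℓ ν, limMass g a = 0) : ∀ᵐ a ∂treeLaw ℓ ν, limMass g a ≠ 0 := by
  set N : Set (Tree ℓ) := {a | limMass g a = 0} with hN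
  have hNm : MeasurableSet N := measurable_limMass hg (measurableSet_singleton 0)
  set p := treeLaw ℓ ν N with hp
  have hsub : ∀ i (a : Tree ℓ), limMass g a = 0 → limMass g (subTree i a) = 0 := fun i a ha => by
    have := mul_limMass_subTree_le (g := g) i a
    rw [ha, nonpos_iff_eq_zero, mul_eq_zero] at this
    simpa [hg0] using this
  let i : Fin ℓ := ⟨0, by omega⟩
  let j : Fin ℓ := ⟨1, by omega⟩
  have hF : Measurable fun x : ℝ × Tree ℓ => N.indicator (1 : Tree ℓ → ℝ≥0∞) x.2 :=
    (measurable_one.indicator hNm).comp measurable_snd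
  have hi : ∀ i, ∫⁻ a, N.indicator (1 : Tree ℓ → ℝ≥0∞) (subTree i a) ∂treeLaw ℓ ν = p :=
    fun i => by
      rw [(measurePreserving_subTree i).lintegral_comp (measurable_one.indicator hNm),
        lintegral_indicator_one hNm]
  have hpp : p ≤ p * p := by
    have := lintegral_branch_mul_branch (ν := ν) (i := i) (j := j) (by simp [i, j]) hF hF
    simp only [hi] at this
    rw [← this, hp, ← lintegral_indicator_one hNm]
    refine lintegral_mono fun a => ?_
    by_cases ha : a ∈ N
    · have h1 : subTree i a ∈ N := hsub i a ha
      have h2 : subTree j a ∈ N := hsub j a ha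
      simp [ha, h1, h2]
    · simp [ha]
  have hp1 : p < 1 := by
    refine lt_of_le_of_ne prob_le_one fun hp1 => h ?_
    exact (prob_compl_eq_zero_iff hNm).2 hp1
  have hp0 : p = 0 := by
    by_contra hp0
    have : p * p < p * 1 := ENNReal.mul_lt_mul_right hp0 (by finiteness) hp1
    rw [mul_one] at this
    exact absurd hpp (not_le.2 this)
  exact measure_eq_zero_iff_ae_notMem.1 hp0

end

/-! ### Positive moments and non-degeneracy of the limit mass -/

section

variable {ℓ : ℕ} {g : ℝ → ℝ≥0} {ν : Measure ℝ} [IsProbabilityMeasure ν]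

/-- For `1 < p ≤ 2`, subadditivity of the power `p - 1` separates the diagonal terms of the `p`-th
power of a sum from products of lower powers of distinct terms. -/
theorem sum_rpow_le {ι : Type*} [DecidableEq ι] (s : Finset ι) (x : ι → ℝ≥0∞) {p : ℝ}
    (hp1 : 1 < p) (hp2 : p ≤ 2) :
    (∑ i ∈ s, x i) ^ p ≤ ∑ i ∈ s, x i ^ p +
      ∑ i ∈ s, ∑ j ∈ s.erase i, x i * x j ^ (p - 1) := by
  have hsub : (∑ i ∈ s, x i) ^ (p - 1) ≤ ∑ i ∈ s, x i ^ (p - 1) := by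
    induction s using Finset.induction_on with
    | empty => simp [ENNReal.zero_rpow_of_pos (sub_pos.2 hp1)]
    | insert i s hi ih =>
      rw [Finset.sum_insert hi, Finset.sum_insert hi]
      exact (ENNReal.rpow_add_le_add_rpow _ _ (by linarith) (by linarith)).trans (by gcongr)
  have hpow : ∀ y : ℝ≥0∞, y ^ p = y * y ^ (p - 1) := fun y => by
    conv_lhs => rw [show p = 1 + (p - 1) by ring,
      ENNReal.rpow_add_of_nonneg _ _ zero_le_one (by linarith), ENNReal.rpow_one]
  calc (∑ i ∈ s, x i) ^ p = (∑ i ∈ s, x i) * (∑ i ∈ s, x i) ^ (p - 1) := hpow _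
    _ ≤ (∑ i ∈ s, x i) * ∑ j ∈ s, x j ^ (p - 1) := by gcongr
    _ = ∑ i ∈ s, (x i ^ p + ∑ j ∈ s.erase i, x i * x j ^ (p - 1)) := by
      rw [Finset.sum_mul]
      refine Finset.sum_congr rfl fun i hi => ?_
      rw [hpow, ← Finset.mul_sum, ← mul_add, Finset.add_sum_erase s (fun j => x j ^ (p - 1)) hi]
    _ = _ := Finset.sum_add_distrib

theorem rpow_le_one_add_self (x : ℝ≥0∞) {θ : ℝ} (h0 : 0 ≤ θ) (h1 : θ ≤ 1) : x ^ θ ≤ 1 + x := by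
  rcases le_total x 1 with hx | hx
  · exact (ENNReal.rpow_le_one hx h0).trans le_self_add
  · calc x ^ θ ≤ x ^ (1 : ℝ) := ENNReal.rpow_le_rpow_of_exponent_le hx h1
      _ ≤ 1 + x := by rw [ENNReal.rpow_one]; exact le_add_self

/-- Splitting a power of the total mass along the first generation, as in `sum_rpow_le`, bounds
the moment of order `p` by a contraction of itself plus products of moments of lower order. -/
theorem exists_lintegral_genMass_rpow_le (hg : Measurable g)
    (hcrit : (ℓ : ℝ≥0∞) * ∫⁻ x, g x ∂ν = 1) {p : ℝ} (hp1 : 1 < p) (hp2 : p ≤ 2)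
    (hgp : (ℓ : ℝ≥0∞) * ∫⁻ x, (g x : ℝ≥0∞) ^ p ∂ν < 1) :
    ∃ K : ℝ≥0∞, K ≠ ∞ ∧ ∀ n, ∫⁻ a, (genMass g n a : ℝ≥0∞) ^ p ∂treeLaw ℓ ν ≤ K := by
  set r := (ℓ : ℝ≥0∞) * ∫⁻ x, (g x : ℝ≥0∞) ^ p ∂ν with hr
  set C : ℝ≥0∞ := ℓ * (ℓ * 2) with hC
  have h1r : 1 - r ≠ 0 := (tsub_pos_of_lt hgp).ne'
  -- the fixed point `K` of `K = r K + 1 + C` bounds the moments by induction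
  refine ⟨(1 + C) / (1 - r), ENNReal.div_ne_top (by finiteness) h1r, fun n => ?_⟩
  set K := (1 + C) / (1 - r) with hK
  have hKr : K * (1 - r) = 1 + C := ENNReal.div_mul_cancel h1r (by finiteness)
  have h1K : 1 ≤ K := by
    refine (ENNReal.le_div_iff_mul_le (Or.inl h1r) (Or.inl (by finiteness))).2 ?_
    rw [one_mul]
    exact tsub_le_self.trans le_self_add
  induction n with
  | zero => simpa [genMass] using h1K
  | succ n ih =>
    have hgm : Measurable fun x => (g x : ℝ≥0∞) := hg.coe_nnreal_ennreal
    have hZm : Measurable fun a : Tree ℓ => (genMass g n a : ℝ≥0∞) :=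
      (measurable_genMass hg n).coe_nnreal_ennreal
    let F : ℝ × Tree ℓ → ℝ≥0∞ := fun x => g x.1 * genMass g n x.2
    have hF : Measurable F := (hgm.comp measurable_fst).mul (hZm.comp measurable_snd)
    have hB : ∀ i : Fin ℓ, Measurable fun a : Tree ℓ => F (a (i, []), subTree i a) := fun i =>
      hF.comp ((measurable_pi_apply _).prodMk (measurable_subTree i))
    have hmean : ∀ i : Fin ℓ, ∫⁻ a, F (a (i, []), subTree i a) ∂treeLaw ℓ ν ≤ 1 := fun i => by
      rw [lintegral_coord_mul_subTree i hgm hZm, lintegral_genMass hg hcrit, mul_one, ← hcrit]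
      have : (1 : ℝ≥0∞) ≤ ℓ := by exact_mod_cast i.pos
      exact le_mul_of_one_le_left zero_le this
    have hdiag : ∀ i : Fin ℓ, ∫⁻ a, F (a (i, []), subTree i a) ^ p ∂treeLaw ℓ ν
        ≤ (∫⁻ x, (g x : ℝ≥0∞) ^ p ∂ν) * K := fun i => by
      simp only [F, ENNReal.mul_rpow_of_nonneg _ _ (zero_le_one.trans hp1.le)]
      rw [lintegral_coord_mul_subTree i (hgm.pow_const p) (hZm.pow_const p)]
      gcongr
    have hoff : ∀ i j : Fin ℓ, i ≠ j → ∫⁻ a, F (a (i, []), subTree i a) *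
        F (a (j, []), subTree j a) ^ (p - 1) ∂treeLaw ℓ ν ≤ 2 := fun i j hij => by
      rw [lintegral_branch_mul_branch hij (G := fun x => F x ^ (p - 1)) hF (hF.pow_const _)]
      have : ∫⁻ a, F (a (j, []), subTree j a) ^ (p - 1) ∂treeLaw ℓ ν ≤ 1 + 1 := by
        calc _ ≤ ∫⁻ a, 1 + F (a (j, []), subTree j a) ∂treeLaw ℓ ν :=
              lintegral_mono fun a => rpow_le_one_add_self _ (by linarith) (by linarith)
          _ = 1 + ∫⁻ a, F (a (j, []), subTree j a) ∂treeLaw ℓ ν := by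
              rw [lintegral_add_left measurable_const]
              simp
          _ ≤ 1 + 1 := by gcongr; exact hmean j
      calc _ ≤ (1 : ℝ≥0∞) * (1 + 1) := mul_le_mul' (hmean i) this
        _ = 2 := by norm_num
    calc ∫⁻ a, (genMass g (n + 1) a : ℝ≥0∞) ^ p ∂treeLaw ℓ ν
        ≤ ∫⁻ a, (∑ i, F (a (i, []), subTree i a) ^ p + ∑ i, ∑ j ∈ Finset.univ.erase i,
            F (a (i, []), subTree i a) * F (a (j, []), subTree j a) ^ (p - 1)) ∂treeLaw ℓ ν := by
          refine lintegral_mono fun a => ?_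
          refine le_trans (le_of_eq ?_) (sum_rpow_le _ _ hp1 hp2)
          simp [genMass, F]
      _ = ∑ i, ∫⁻ a, F (a (i, []), subTree i a) ^ p ∂treeLaw ℓ ν +
            ∑ i, ∑ j ∈ Finset.univ.erase i, ∫⁻ a, F (a (i, []), subTree i a) *
              F (a (j, []), subTree j a) ^ (p - 1) ∂treeLaw ℓ ν := by
          have hm : ∀ i j : Fin ℓ, Measurable fun a : Tree ℓ => F (a (i, []), subTree i a) *
              F (a (j, []), subTree j a) ^ (p - 1) := fun i j =>
            (hB i).mul ((hB j).pow_const _)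
          rw [lintegral_add_left, lintegral_finsetSum, lintegral_finsetSum]
          · congr 1
            refine Finset.sum_congr rfl fun i _ => ?_
            rw [lintegral_finsetSum]
            exact fun j _ => hm i j
          · exact fun i _ => Finset.measurable_fun_sum _ fun j _ => hm i j
          · exact fun i _ => (hB i).pow_const _
          · exact Finset.measurable_fun_sum _ fun i _ => (hB i).pow_const _
      _ ≤ ∑ _i : Fin ℓ, (∫⁻ x, (g x : ℝ≥0∞) ^ p ∂ν) * K + ∑ _i : Fin ℓ, ∑ _j : Fin ℓ, 2 := by
          gcongr with i _ i _
          · exact hdiag i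
          · refine (Finset.sum_le_sum fun j hj =>
              hoff i j (Finset.ne_of_mem_erase hj).symm).trans ?_
            exact Finset.sum_le_sum_of_subset (Finset.erase_subset _ _)
      _ = r * K + C := by simp [hr, hC, mul_assoc]
      _ ≤ r * K + K * (1 - r) := by rw [hKr]; gcongr; exact le_add_self
      _ = K := by
          rw [mul_comm r, ← mul_add, add_tsub_cancel_of_le hgp.le, mul_one]

theorem lintegral_limMass_rpow_ne_top (hg : Measurable g)
    (hcrit : (ℓ : ℝ≥0∞) * ∫⁻ x, g x ∂ν = 1) {p : ℝ} (hp1 : 1 < p) (hp2 : p ≤ 2)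
    (hgp : (ℓ : ℝ≥0∞) * ∫⁻ x, (g x : ℝ≥0∞) ^ p ∂ν < 1) :
    ∫⁻ a, limMass g a ^ p ∂treeLaw ℓ ν ≠ ∞ := by
  obtain ⟨K, hK, hKn⟩ := exists_lintegral_genMass_rpow_le hg hcrit hp1 hp2 hgp
  refine ne_top_of_le_ne_top hK ?_
  calc ∫⁻ a, limMass g a ^ p ∂treeLaw ℓ ν
      ≤ ∫⁻ a, liminf (fun n => (genMass g n a : ℝ≥0∞) ^ p) atTop ∂treeLaw ℓ ν := by
        refine lintegral_mono_ae ?_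
        filter_upwards [ae_tendsto_genMass hg hcrit] with a ⟨c, hc⟩
        rw [limMass_eq_of_tendsto hc]
        exact ((ENNReal.continuous_rpow_const.tendsto _).comp
          (ENNReal.tendsto_coe.2 hc)).liminf_eq.ge
    _ ≤ liminf (fun n => ∫⁻ a, (genMass g n a : ℝ≥0∞) ^ p ∂treeLaw ℓ ν) atTop :=
        lintegral_liminf_le fun n => (measurable_genMass hg n).coe_nnreal_ennreal.pow_const p
    _ ≤ liminf (fun _ : ℕ => K) atTop := liminf_le_liminf (Eventually.of_forall hKn)
    _ = K := by simp

/-- A cascade bounded in `L^p` with `p > 1` is uniformly integrable, and so does not vanish in the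
limit. -/
theorem not_ae_limMass_eq_zero (hg : Measurable g)
    (hcrit : (ℓ : ℝ≥0∞) * ∫⁻ x, g x ∂ν = 1) {p : ℝ} (hp1 : 1 < p) (hp2 : p ≤ 2)
    (hgp : (ℓ : ℝ≥0∞) * ∫⁻ x, (g x : ℝ≥0∞) ^ p ∂ν < 1) :
    ¬ ∀ᵐ a ∂treeLaw ℓ ν, limMass g a = 0 := by
  intro h0
  obtain ⟨K, hK, hKn⟩ := exists_lintegral_genMass_rpow_le hg hcrit hp1 hp2 hgp
  -- a truncation level `M` with `K / M ^ (p - 1) < 1`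
  obtain ⟨M, hM0, hM⟩ : ∃ M : ℝ≥0, 0 < M ∧ ((M : ℝ≥0∞) ^ (p - 1))⁻¹ * K < 1 := by
    have h1 : Tendsto (fun M : ℝ≥0 => ((M : ℝ≥0∞) ^ (p - 1))⁻¹ * K) atTop (𝓝 (0 * K)) := by
      refine ENNReal.Tendsto.mul_const ?_ (Or.inr hK)
      rw [← ENNReal.inv_top]
      refine tendsto_inv_iff.2 ?_
      have := ((ENNReal.tendsto_rpow_at_top (sub_pos.2 hp1)).comp
        (ENNReal.tendsto_coe_nhds_top.2 tendsto_id))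
      exact this
    rw [zero_mul] at h1
    obtain ⟨M, h1, h2⟩ := ((h1.eventually_lt_const one_pos).and (eventually_gt_atTop 0)).exists
    exact ⟨M, h2, h1⟩
  have hbound : ∀ z : ℝ≥0∞, z ≤ min z M + ((M : ℝ≥0∞) ^ (p - 1))⁻¹ * z ^ p := by
    intro z
    rcases le_total z M with hz | hz
    · rw [min_eq_left hz]; exact le_self_add
    · refine le_trans ?_ le_add_self
      have hMp : (M : ℝ≥0∞) ^ (p - 1) ≠ 0 := by simp [hM0.ne']
      have hMt : (M : ℝ≥0∞) ^ (p - 1) ≠ ∞ :=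
        ENNReal.rpow_ne_top_of_nonneg (by linarith) ENNReal.coe_ne_top
      rw [← ENNReal.mul_le_mul_iff_right hMp hMt, ← mul_assoc, ENNReal.mul_inv_cancel hMp hMt,
        one_mul]
      calc (M : ℝ≥0∞) ^ (p - 1) * z ≤ z ^ (p - 1) * z := by gcongr
        _ = z ^ p := by
          conv_rhs => rw [show p = (p - 1) + 1 by ring,
            ENNReal.rpow_add_of_nonneg _ _ (by linarith) zero_le_one, ENNReal.rpow_one]
  have hlim : Tendsto (fun n => ∫⁻ a, min (genMass g n a : ℝ≥0∞) M ∂treeLaw ℓ ν) atTop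
      (𝓝 (∫⁻ _, 0 ∂treeLaw ℓ ν)) := by
    refine tendsto_lintegral_of_dominated_convergence (fun _ => (M : ℝ≥0∞))
      (fun n => (measurable_genMass hg n).coe_nnreal_ennreal.min measurable_const)
      (fun n => ae_of_all _ fun a => min_le_right _ _) (by simp) ?_
    filter_upwards [h0, ae_tendsto_genMass hg hcrit] with a ha ⟨c, hc⟩
    rw [limMass_eq_of_tendsto hc] at ha
    have := (ENNReal.tendsto_coe.2 hc).min (tendsto_const_nhds (x := (M : ℝ≥0∞)))
    simpa [ha] using this
  have hle : ∀ n, 1 ≤ ∫⁻ a, min (genMass g n a : ℝ≥0∞) M ∂treeLaw ℓ ν +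
      ((M : ℝ≥0∞) ^ (p - 1))⁻¹ * K := fun n => by
    calc 1 = ∫⁻ a, (genMass g n a : ℝ≥0∞) ∂treeLaw ℓ ν := (lintegral_genMass hg hcrit n).symm
      _ ≤ ∫⁻ a, (min (genMass g n a : ℝ≥0∞) M +
          ((M : ℝ≥0∞) ^ (p - 1))⁻¹ * (genMass g n a : ℝ≥0∞) ^ p) ∂treeLaw ℓ ν :=
        lintegral_mono fun a => hbound _
      _ = ∫⁻ a, min (genMass g n a : ℝ≥0∞) M ∂treeLaw ℓ ν +
          ((M : ℝ≥0∞) ^ (p - 1))⁻¹ * ∫⁻ a, (genMass g n a : ℝ≥0∞) ^ p ∂treeLaw ℓ ν := by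
        have hm := (measurable_genMass (ℓ := ℓ) hg n).coe_nnreal_ennreal
        rw [lintegral_add_left (hm.min measurable_const),
          lintegral_const_mul _ (hm.pow_const p)]
      _ ≤ _ := by gcongr; exact hKn n
  have := le_of_tendsto_of_tendsto' tendsto_const_nhds
    (hlim.add_const (((M : ℝ≥0∞) ^ (p - 1))⁻¹ * K)) hle
  simp only [lintegral_zero, zero_add] at this
  exact absurd hM (not_lt.2 this)

/-- The tail at zero of the limit mass: if the limit mass is at most `t * t`, then, on each of two
independent branches, the weight or the limit mass is at most `t`. -/
theorem measure_limMass_le_mul_self (hℓ : 2 ≤ ℓ) (hg : Measurable g) (t : ℝ≥0∞) :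
    treeLaw ℓ ν {a | limMass g a ≤ t * t} ≤
      (treeLaw ℓ ν {a | limMass g a ≤ t} + ν {x | (g x : ℝ≥0∞) ≤ t}) ^ 2 := by
  let i : Fin ℓ := ⟨0, by omega⟩
  let j : Fin ℓ := ⟨1, by omega⟩
  let S : Set (ℝ × Tree ℓ) := {x | limMass g x.2 ≤ t ∨ (g x.1 : ℝ≥0∞) ≤ t}
  have h1 : MeasurableSet {a : Tree ℓ | limMass g a ≤ t} :=
    measurableSet_le (measurable_limMass hg) measurable_const
  have h2 : MeasurableSet {x | (g x : ℝ≥0∞) ≤ t} :=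
    measurableSet_le hg.coe_nnreal_ennreal measurable_const
  have hS : MeasurableSet S := (h1.preimage measurable_snd).union (h2.preimage measurable_fst)
  have hF : Measurable (S.indicator (1 : ℝ × Tree ℓ → ℝ≥0∞)) := measurable_one.indicator hS
  have hone : ∀ i : Fin ℓ,
      ∫⁻ a, S.indicator (1 : ℝ × Tree ℓ → ℝ≥0∞) (a (i, []), subTree i a) ∂treeLaw ℓ ν
      ≤ treeLaw ℓ ν {a | limMass g a ≤ t} + ν {x | (g x : ℝ≥0∞) ≤ t} := fun i => by
    rw [← lintegral_indicator_one h1, ← lintegral_indicator_one h2,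
      ← lintegral_coord (ℓ := ℓ) (i, []) (measurable_one.indicator h2),
      ← (measurePreserving_subTree i).lintegral_comp (measurable_one.indicator h1),
      ← lintegral_add_left (f := fun a : Tree ℓ => {a | limMass g a ≤ t}.indicator 1 (subTree i a))
        ((measurable_one.indicator h1).comp (measurable_subTree i))]
    refine lintegral_mono fun a => ?_
    by_cases ha : limMass g (subTree i a) ≤ t <;> by_cases hb : (g (a (i, [])) : ℝ≥0∞) ≤ t <;>
      simp [S, ha, hb, Set.indicator]
  calc treeLaw ℓ ν {a | limMass g a ≤ t * t}
      = ∫⁻ a, {a | limMass g a ≤ t * t}.indicator 1 a ∂treeLaw ℓ ν :=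
        (lintegral_indicator_one (measurableSet_le (measurable_limMass hg) measurable_const)).symm
    _ ≤ ∫⁻ a, S.indicator (1 : ℝ × Tree ℓ → ℝ≥0∞) (a (i, []), subTree i a) *
          S.indicator (1 : ℝ × Tree ℓ → ℝ≥0∞) (a (j, []), subTree j a) ∂treeLaw ℓ ν := by
        refine lintegral_mono fun a => ?_
        by_cases ha : a ∈ {a | limMass g a ≤ t * t}
        swap
        · rw [Set.indicator_of_notMem ha]
          exact zero_le
        have hmem : ∀ k : Fin ℓ, (a (k, []), subTree k a) ∈ S := fun k => by
          by_contra hk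
          simp only [S, Set.mem_ofPred_eq, not_or, not_le] at hk
          exact absurd ((mul_limMass_subTree_le k a).trans ha)
            (not_le.2 (ENNReal.mul_lt_mul hk.2 hk.1))
        rw [Set.indicator_of_mem (hmem i), Set.indicator_of_mem (hmem j), Set.indicator_of_mem ha]
        simp
    _ = _ := lintegral_branch_mul_branch (by simp [i, j]) hF hF
    _ ≤ _ := by rw [sq]; exact mul_le_mul' (hone i) (hone j)

end

/-! ### Negative moments of the limit mass -/

section

variable {ℓ : ℕ} {g : ℝ → ℝ≥0} {ν : Measure ℝ} [IsProbabilityMeasure ν]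

theorem rpow_neg_anti {x y : ℝ≥0∞} (h : x ≤ y) {r : ℝ} (hr : 0 ≤ r) : y ^ (-r) ≤ x ^ (-r) := by
  rw [ENNReal.rpow_neg, ENNReal.rpow_neg]
  exact ENNReal.inv_le_inv.2 (ENNReal.rpow_le_rpow h hr)

/-- A number in `(0, 1)` and its iterated squares cut `(0, ∞]` into pieces, on each of which a
negative power varies by a controlled factor. -/
theorem rpow_neg_le_tsum {t : ℝ≥0∞} (ht1 : t < 1) {r : ℝ} (hr : 0 < r) {z : ℝ≥0∞}
    (hz : z ≠ 0) :
    z ^ (-r) ≤ t ^ (-r) +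
      ∑' k : ℕ, (t ^ (-(2 * r))) ^ 2 ^ k * {x | x ≤ t ^ 2 ^ k}.indicator 1 z := by
  by_cases hzt : t < z
  · exact le_add_right (rpow_neg_anti hzt.le hr.le)
  have hex : ∃ k : ℕ, t ^ 2 ^ k < z := by
    have h := (ENNReal.tendsto_pow_atTop_nhds_zero_of_lt_one ht1).comp
      (tendsto_pow_atTop_atTop_of_one_lt (one_lt_two : (1 : ℕ) < 2))
    exact (h.eventually_lt_const (pos_iff_ne_zero.2 hz)).exists
  obtain ⟨k, hk⟩ : ∃ k, Nat.find hex = k + 1 := by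
    refine Nat.exists_eq_succ_of_ne_zero fun h0 => hzt ?_
    simpa [h0] using Nat.find_spec hex
  have h1 : t ^ 2 ^ (k + 1) < z := hk ▸ Nat.find_spec hex
  have h2 : z ≤ t ^ 2 ^ k := not_lt.1 (Nat.find_min hex (hk ▸ Nat.lt_succ_self k))
  refine le_trans ?_ le_add_self
  refine le_trans ?_ (ENNReal.le_tsum k)
  simp only [Set.indicator, Set.mem_ofPred_eq, h2, if_true, Pi.one_apply, mul_one]
  calc z ^ (-r) ≤ (t ^ 2 ^ (k + 1)) ^ (-r) := rpow_neg_anti h1.le hr.le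
    _ = (t ^ (-(2 * r))) ^ 2 ^ k := by
      rw [← ENNReal.rpow_natCast, ← ENNReal.rpow_natCast, ← ENNReal.rpow_mul, ← ENNReal.rpow_mul]
      congr 1
      push_cast
      ring

/-- The limit mass has a finite moment of some negative order. With
`θ t = 2 (P[limMass ≤ t] + c t)`, `measure_limMass_le_mul_self` gives `θ (t * t) ≤ (θ t) ^ 2`, so
that the tail at zero decays like a power along the iterated squares of some `t`. -/
theorem exists_lintegral_limMass_rpow_neg_ne_top (hℓ : 2 ≤ ℓ) (hg : Measurable g)
    (hginv : ∫⁻ x, (g x : ℝ≥0∞)⁻¹ ∂ν ≠ ∞)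
    (hpos : ∀ᵐ a ∂treeLaw ℓ ν, limMass g a ≠ 0) :
    ∃ r : ℝ, 0 < r ∧ ∫⁻ a, limMass g a ^ (-r) ∂treeLaw ℓ ν ≠ ∞ := by
  set c : ℝ≥0∞ := max 1 (∫⁻ x, (g x : ℝ≥0∞)⁻¹ ∂ν) with hc
  have hc1 : 1 ≤ c := le_max_left _ _
  have hctop : c ≠ ∞ := by simp [hc, hginv]
  set ψ : ℝ≥0∞ → ℝ≥0∞ := fun t => treeLaw ℓ ν {a | limMass g a ≤ t} with hψ
  have hm : ∀ t, MeasurableSet {a : Tree ℓ | limMass g a ≤ t} := fun t =>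
    measurableSet_le (measurable_limMass hg) measurable_const
  have hmarkov : ∀ t : ℝ≥0∞, t ≠ 0 → t ≠ ∞ → ν {x | (g x : ℝ≥0∞) ≤ t} ≤ c * t := by
    intro t ht0 ht
    have h := mul_meas_ge_le_lintegral (μ := ν) (f := fun x => (g x : ℝ≥0∞)⁻¹)
      hg.coe_nnreal_ennreal.inv t⁻¹
    simp only [ENNReal.inv_le_inv] at h
    calc ν {x | (g x : ℝ≥0∞) ≤ t} = t * (t⁻¹ * ν {x | (g x : ℝ≥0∞) ≤ t}) := by
          rw [← mul_assoc, ENNReal.mul_inv_cancel ht0 ht, one_mul]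
      _ ≤ t * c := by gcongr; exact h.trans (le_max_right _ _)
      _ = c * t := mul_comm _ _
  set θ : ℝ≥0∞ → ℝ≥0∞ := fun t => 2 * (ψ t + c * t) with hθ
  have hθsq : ∀ t : ℝ≥0∞, t ≠ 0 → t ≠ ∞ → θ (t * t) ≤ θ t ^ 2 := by
    intro t ht0 ht
    have h1 : ψ (t * t) ≤ (ψ t + c * t) ^ 2 :=
      (measure_limMass_le_mul_self hℓ hg t).trans (by gcongr; exact hmarkov t ht0 ht)
    have h2 : c * (t * t) ≤ (ψ t + c * t) ^ 2 := by
      calc c * (t * t) ≤ c * c * (t * t) := by gcongr; exact le_mul_of_one_le_left zero_le hc1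
        _ = (c * t) ^ 2 := by ring
        _ ≤ _ := by gcongr; exact le_add_self
    calc θ (t * t) ≤ 2 * ((ψ t + c * t) ^ 2 + (ψ t + c * t) ^ 2) := by
          simp only [hθ]; gcongr
      _ = θ t ^ 2 := by simp only [hθ]; ring
  -- `θ` tends to `0` at `0`
  have hθ0 : Tendsto θ (𝓝[>] 0) (𝓝 0) := by
    have h1 : Tendsto ψ (𝓝[>] 0) (𝓝 0) := by
      have := tendsto_measure_biInter_gt (μ := treeLaw ℓ ν)
        (s := fun t : ℝ≥0∞ => {a : Tree ℓ | limMass g a ≤ t}) (a := 0)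
        (fun t _ => (hm t).nullMeasurableSet)
        (fun s t _ hst a (ha : limMass g a ≤ s) => ha.trans hst)
        ⟨1, one_pos, by finiteness⟩
      have h0 : treeLaw ℓ ν (⋂ t > (0 : ℝ≥0∞), {a : Tree ℓ | limMass g a ≤ t}) = 0 := by
        refine measure_mono_null (fun a ha => ?_) (ae_iff.1 hpos)
        simp only [Set.mem_iInter, Set.mem_ofPred_eq, gt_iff_lt] at ha
        simpa using le_of_forall_gt_imp_ge_of_dense ha
      rwa [h0] at this
    have h2 : Tendsto (fun t : ℝ≥0∞ => c * t) (𝓝[>] 0) (𝓝 (c * 0)) :=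
      ENNReal.Tendsto.const_mul (tendsto_id.mono_left nhdsWithin_le_nhds) (Or.inr hctop)
    have := ENNReal.Tendsto.const_mul (a := 2) (h1.add h2) (Or.inr (by finiteness))
    simpa using this
  obtain ⟨t, ⟨hθt, ht1⟩, ht0⟩ : ∃ t : ℝ≥0∞, (θ t < 1 ∧ t < 1) ∧ 0 < t := by
    have h1 := hθ0.eventually_lt_const one_pos
    have h2 : ∀ᶠ t : ℝ≥0∞ in 𝓝[>] 0, t < 1 :=
      nhdsWithin_le_nhds (eventually_lt_nhds one_pos)
    exact ((h1.and h2).and self_mem_nhdsWithin).exists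
  have htt : t ≠ ∞ := ht1.ne_top
  have hiter : ∀ k : ℕ, θ (t ^ 2 ^ k) ≤ θ t ^ 2 ^ k := by
    intro k
    induction k with
    | zero => simp
    | succ k ih =>
      calc θ (t ^ 2 ^ (k + 1)) = θ (t ^ 2 ^ k * t ^ 2 ^ k) := by
            rw [← pow_add, pow_succ, mul_two]
        _ ≤ θ (t ^ 2 ^ k) ^ 2 := hθsq _ (pow_ne_zero _ ht0.ne') (by finiteness)
        _ ≤ (θ t ^ 2 ^ k) ^ 2 := by gcongr
        _ = θ t ^ 2 ^ (k + 1) := by rw [← pow_mul, pow_succ]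
  have hψθ : ∀ s, ψ s ≤ θ s := fun s => by
    simp only [hθ, two_mul]
    exact le_self_add.trans le_self_add
  -- an exponent `r` small enough for the series below to converge
  obtain ⟨r, hr0, hr⟩ : ∃ r : ℝ, 0 < r ∧ t ^ (-(2 * r)) * θ t < 1 := by
    have hcont : Tendsto (fun r : ℝ => t ^ (-(2 * r)) * θ t) (𝓝[>] 0) (𝓝 (1 * θ t)) := by
      refine ENNReal.Tendsto.mul_const ?_ (Or.inr (hθt.ne_top))
      have h1 : ∀ r : ℝ, t ^ (-(2 * r)) = ENNReal.ofReal (t.toReal ^ (-(2 * r))) := fun r => by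
        rw [← ENNReal.ofReal_rpow_of_pos (ENNReal.toReal_pos ht0.ne' htt),
          ENNReal.ofReal_toReal htt]
      simp_rw [h1]
      have h2 : Continuous fun r : ℝ => t.toReal ^ (-(2 * r)) :=
        Continuous.rpow (by fun_prop) (by fun_prop)
          fun r => Or.inl (ENNReal.toReal_pos ht0.ne' htt).ne'
      have h3 := (ENNReal.continuous_ofReal.comp h2).tendsto 0
      simp only [Function.comp_apply, mul_zero, neg_zero, Real.rpow_zero, ENNReal.ofReal_one] at h3
      exact h3.mono_left nhdsWithin_le_nhds
    rw [one_mul] at hcont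
    obtain ⟨r, h1, h2⟩ := ((hcont.eventually_lt_const hθt).and self_mem_nhdsWithin).exists
    exact ⟨r, h2, h1⟩
  refine ⟨r, hr0, ne_top_of_le_ne_top (b := t ^ (-r) + ∑' k : ℕ, (t ^ (-(2 * r)) * θ t) ^ k) ?_ ?_⟩
  · have h1 : t ^ (-r) ≠ ∞ := by
      rw [ENNReal.rpow_neg]
      simp [ht0.ne', htt]
    refine ENNReal.add_ne_top.2 ⟨h1, ?_⟩
    rw [ENNReal.tsum_geometric]
    exact ENNReal.inv_ne_top.2 (tsub_pos_of_lt hr).ne'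
  · have hind : ∀ k : ℕ, Measurable fun a : Tree ℓ =>
        {x : ℝ≥0∞ | x ≤ t ^ 2 ^ k}.indicator (1 : ℝ≥0∞ → ℝ≥0∞) (limMass g a) := fun k =>
      (measurable_one.indicator measurableSet_Iic).comp (measurable_limMass hg)
    calc ∫⁻ a, limMass g a ^ (-r) ∂treeLaw ℓ ν
        ≤ ∫⁻ a, (t ^ (-r) + ∑' k : ℕ, (t ^ (-(2 * r))) ^ 2 ^ k *
            {x | x ≤ t ^ 2 ^ k}.indicator 1 (limMass g a)) ∂treeLaw ℓ ν := by
          refine lintegral_mono_ae ?_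
          filter_upwards [hpos] with a ha using rpow_neg_le_tsum ht1 hr0 ha
      _ = t ^ (-r) + ∑' k : ℕ, (t ^ (-(2 * r))) ^ 2 ^ k * ψ (t ^ 2 ^ k) := by
          rw [lintegral_add_left measurable_const, lintegral_tsum
            (fun k => ((hind k).const_mul _).aemeasurable)]
          congr 1
          · simp
          · refine tsum_congr fun k => ?_
            rw [lintegral_const_mul _ (hind k)]
            congr 1
            exact lintegral_indicator_one (hm _)
      _ ≤ t ^ (-r) + ∑' k : ℕ, (t ^ (-(2 * r)) * θ t) ^ k := by
          gcongr with k
          calc (t ^ (-(2 * r))) ^ 2 ^ k * ψ (t ^ 2 ^ k)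
              ≤ (t ^ (-(2 * r))) ^ 2 ^ k * θ t ^ 2 ^ k := by
                gcongr; exact (hψθ _).trans (hiter k)
            _ = (t ^ (-(2 * r)) * θ t) ^ 2 ^ k := (mul_pow _ _ _).symm
            _ ≤ (t ^ (-(2 * r)) * θ t) ^ k :=
                pow_le_pow_right_of_le_one' hr.le Nat.lt_two_pow_self.le

theorem rpow_le_one_add_add (z : ℝ≥0∞) {r u : ℝ} (h0 : -r ≤ u) (h1 : u ≤ 1) :
    z ^ u ≤ z + z ^ (-r) := by
  rcases le_total z 1 with hz | hz
  · exact (ENNReal.rpow_le_rpow_of_exponent_ge hz h0).trans le_add_self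
  · calc z ^ u ≤ z ^ (1 : ℝ) := ENNReal.rpow_le_rpow_of_exponent_le hz h1
      _ ≤ _ := by rw [ENNReal.rpow_one]; exact le_self_add

/-- By Young's inequality, `X * Z ^ s` is integrable for all small exponents `s` of both signs,
as soon as `X` has a moment of order `p > 1` and `Z` has a mean and a moment of some negative
order. -/
theorem exists_forall_lintegral_mul_rpow_ne_top {Ω : Type*} [MeasurableSpace Ω] {P : Measure Ω}
    {X Z : Ω → ℝ≥0∞} (hX : Measurable X) (hZ : Measurable Z) {p r : ℝ} (hp : 1 < p) (hr : 0 < r)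
    (hXp : ∫⁻ ω, X ω ^ p ∂P ≠ ∞) (hZ1 : ∫⁻ ω, Z ω ∂P ≠ ∞) (hZr : ∫⁻ ω, Z ω ^ (-r) ∂P ≠ ∞) :
    ∃ s₀ : ℝ, 0 < s₀ ∧ ∀ s : ℝ, |s| < s₀ → ∫⁻ ω, X ω * Z ω ^ s ∂P ≠ ∞ := by
  have hpq := Real.HolderConjugate.conjExponent hp
  set p' := p.conjExponent
  have hp' : 0 < p' := hpq.symm.pos
  refine ⟨min r 1 / p', by positivity, fun s hs => ?_⟩
  rw [lt_div_iff₀ hp', ← abs_of_pos hp', ← abs_mul, abs_lt] at hs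
  have hp1 : 1 ≤ ENNReal.ofReal p := ENNReal.one_le_ofReal.2 hp.le
  have hp1' : 1 ≤ ENNReal.ofReal p' := ENNReal.one_le_ofReal.2 hpq.symm.lt.le
  refine ne_top_of_le_ne_top
    (b := ∫⁻ ω, X ω ^ p ∂P + (∫⁻ ω, Z ω ∂P + ∫⁻ ω, Z ω ^ (-r) ∂P)) (by finiteness) ?_
  rw [← lintegral_add_left hZ, ← lintegral_add_left (hX.pow_const p)]
  refine lintegral_mono fun ω => ?_
  calc X ω * Z ω ^ s ≤ X ω ^ p / ENNReal.ofReal p + (Z ω ^ s) ^ p' / ENNReal.ofReal p' :=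
        ENNReal.young_inequality _ _ hpq
    _ ≤ X ω ^ p + (Z ω ^ s) ^ p' := by
        gcongr
        · exact ENNReal.div_le_of_le_mul (le_mul_of_one_le_right zero_le hp1)
        · exact ENNReal.div_le_of_le_mul (le_mul_of_one_le_right zero_le hp1')
    _ ≤ _ := by
        rw [← ENNReal.rpow_mul]
        gcongr
        have h1 := min_le_left r 1
        have h2 := min_le_right r 1
        exact rpow_le_one_add_add _ (by linarith) (by linarith)

end

/-! ### Weak convergence of the cascade measures -/

section

open BoundedContinuousFunction

variable {ℓ : ℕ} {g : ℝ → ℝ≥0}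

/-- The affine map that carries `[0, 1)` onto the cell of the letter `i`. -/
def childMap (i : Fin ℓ) (x : ℝ) : ℝ := (x + i) / ℓ

@[fun_prop]
theorem continuous_childMap (i : Fin ℓ) : Continuous (childMap i) := by
  unfold childMap; fun_prop

theorem childMap_mem_Icc (i : Fin ℓ) {x : ℝ} (hx : x ∈ Set.Icc (0 : ℝ) 1) :
    childMap i x ∈ Set.Icc (0 : ℝ) 1 := by
  have h1 : ((i : ℕ) : ℝ) + 1 ≤ ℓ := by exact_mod_cast i.isLt
  have h2 : (0 : ℝ) ≤ (i : ℕ) := by positivity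
  have h3 : (0 : ℝ) < ℓ := by linarith
  rw [childMap, Set.mem_Icc, div_le_one h3]
  exact ⟨div_nonneg (by linarith [hx.1]) h3.le, by linarith [hx.2]⟩

/-- The `n`-th approximation of the cascade measure with edge weights `g`, built from the first
generation down: each letter contributes a scaled copy of the approximation of its subtree. -/
def genMeasure (g : ℝ → ℝ≥0) : ℕ → Tree ℓ → FiniteMeasure ℝ
  | 0, _ => ⟨volume.restrict (Set.Ico 0 1), inferInstance⟩
  | n + 1, a => ∑ i, g (a (i, [])) • (genMeasure g n (subTree i a)).map (childMap i)

theorem mass_genMeasure (n : ℕ) (a : Tree ℓ) : (genMeasure g n a).mass = genMass g n a := by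
  induction n generalizing a with
  | zero => simp [genMeasure, genMass, FiniteMeasure.mass, FiniteMeasure.mk_apply]
  | succ n ih =>
    rw [← ENNReal.coe_inj, FiniteMeasure.ennreal_mass, genMeasure, genMass]
    simp only [FiniteMeasure.toMeasure_sum, FiniteMeasure.toMeasure_smul,
      FiniteMeasure.toMeasure_map, Measure.coe_finsetSum, Finset.sum_apply, Measure.smul_apply,
      ENNReal.ofNNReal_finsetSum, ENNReal.coe_mul]
    refine Finset.sum_congr rfl fun i _ => ?_
    rw [Measure.map_apply (continuous_childMap i).measurable MeasurableSet.univ, Set.preimage_univ,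
      ← FiniteMeasure.ennreal_mass, ih]
    rfl

theorem toMeasure_sum_smul_map_apply (c : Fin ℓ → ℝ≥0) (μ : Fin ℓ → FiniteMeasure ℝ) {s : Set ℝ}
    (hs : MeasurableSet s) :
    ((∑ i, c i • (μ i).map (childMap i) : FiniteMeasure ℝ) : Measure ℝ) s
      = ∑ i, (c i : ℝ≥0∞) * (μ i : Measure ℝ) (childMap i ⁻¹' s) := by
  simp only [FiniteMeasure.toMeasure_sum, FiniteMeasure.toMeasure_smul,
    FiniteMeasure.toMeasure_map, Measure.coe_finsetSum, Finset.sum_apply, Measure.smul_apply]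
  refine Finset.sum_congr rfl fun i _ => ?_
  rw [Measure.map_apply (continuous_childMap i).measurable hs]
  rfl

theorem genMeasure_compl_Icc (n : ℕ) (a : Tree ℓ) :
    (genMeasure g n a : Measure ℝ) (Set.Icc 0 1)ᶜ = 0 := by
  induction n generalizing a with
  | zero =>
    simp only [genMeasure, FiniteMeasure.toMeasure_mk]
    rw [Measure.restrict_apply measurableSet_Icc.compl]
    convert measure_empty (μ := (volume : Measure ℝ))
    exact Set.eq_empty_of_forall_notMem fun x hx => hx.1 (Set.Ico_subset_Icc_self hx.2)
  | succ n ih =>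
    rw [genMeasure, toMeasure_sum_smul_map_apply _ _ measurableSet_Icc.compl]
    refine Finset.sum_eq_zero fun i _ => ?_
    have hsub : childMap i ⁻¹' (Set.Icc 0 1)ᶜ ⊆ (Set.Icc 0 1)ᶜ :=
      fun x hx hx' => hx (childMap_mem_Icc i hx')
    rw [measure_mono_null hsub (ih (subTree i a)), mul_zero]

theorem integral_genMeasure_succ (n : ℕ) (a : Tree ℓ) (f : ℝ →ᵇ ℝ) :
    ∫ x, f x ∂(genMeasure g (n + 1) a : Measure ℝ)
      = ∑ i, (g (a (i, [])) : ℝ) *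
        ∫ x, f (childMap i x) ∂(genMeasure g n (subTree i a) : Measure ℝ) := by
  rw [genMeasure, FiniteMeasure.toMeasure_sum, integral_finsetSum_measure]
  · refine Finset.sum_congr rfl fun i _ => ?_
    rw [FiniteMeasure.toMeasure_smul, integral_smul_nnreal_measure, FiniteMeasure.toMeasure_map,
      integral_map (continuous_childMap i).aemeasurable
        f.continuous.aestronglyMeasurable]
    rfl
  · exact fun i _ => f.integrable _

/-- The total masses of the tree and of all its subtrees converge. -/
def Convergent (g : ℝ → ℝ≥0) (a : Tree ℓ) : Prop :=
  ∀ w, ∃ c : ℝ≥0, Tendsto (fun n => genMass g n (subTreeAt w a)) atTop (𝓝 c)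

theorem Convergent.subTree {a : Tree ℓ} (h : Convergent g a) (i : Fin ℓ) :
    Convergent g (subTree i a) := fun w => h (i :: w)

theorem Convergent.tendsto_genMass {a : Tree ℓ} (h : Convergent g a) :
    ∃ c : ℝ≥0, Tendsto (fun n => genMass g n a) atTop (𝓝 c) := h []

/-- The integrals of a function that varies by at most `ε` on the cells of the generation `N` are,
up to `ε` times the total mass, a combination of the masses of these cells, and the latter
converge. -/
theorem exists_tendsto_abs_integral_sub_le (N : ℕ) {ε : ℝ} (f : ℝ →ᵇ ℝ)
    (hf : ∀ x ∈ Set.Icc (0 : ℝ) 1, ∀ y ∈ Set.Icc (0 : ℝ) 1,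
      |x - y| ≤ ((ℓ : ℝ) ^ N)⁻¹ → |f x - f y| ≤ ε) {a : Tree ℓ} (ha : Convergent g a) :
    ∃ (c : ℕ → ℝ) (L : ℝ), Tendsto c atTop (𝓝 L) ∧
      ∀ n, N ≤ n → |∫ x, f x ∂(genMeasure g n a : Measure ℝ) - c n| ≤ ε * genMass g n a := by
  induction N generalizing f a with
  | zero =>
    obtain ⟨L, hL⟩ := ha.tendsto_genMass
    refine ⟨fun n => f 0 * genMass g n a, f 0 * L,
      (NNReal.tendsto_coe.2 hL).const_mul _, fun n _ => ?_⟩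
    have hreal : (genMeasure g n a : Measure ℝ).real Set.univ = genMass g n a := by
      rw [← mass_genMeasure]; rfl
    have h1 : ∫ x, f x ∂(genMeasure g n a : Measure ℝ) - f 0 * genMass g n a
        = ∫ x, (f x - f 0) ∂(genMeasure g n a : Measure ℝ) := by
      rw [integral_sub (f.integrable (genMeasure g n a : Measure ℝ)) (integrable_const _),
        integral_const, hreal, smul_eq_mul,
        mul_comm]
    rw [h1, ← hreal]
    refine norm_integral_le_of_norm_le_const (μ := (genMeasure g n a : Measure ℝ))
      (f := fun x => f x - f 0) (C := ε) ?_
    filter_upwards [measure_eq_zero_iff_ae_notMem.1 (genMeasure_compl_Icc (g := g) n a)] with x hx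
    simp only [Set.mem_compl_iff, not_not] at hx
    refine hf x hx 0 (by simp) ?_
    simpa [abs_of_nonneg hx.1] using hx.2
  | succ N ih =>
    have hi : ∀ i : Fin ℓ, ∃ (c : ℕ → ℝ) (L : ℝ), Tendsto c atTop (𝓝 L) ∧ ∀ n, N ≤ n →
        |∫ x, f (childMap i x) ∂(genMeasure g n (CascadeTree.subTree i a) : Measure ℝ) - c n|
          ≤ ε * genMass g n (CascadeTree.subTree i a) := by
      intro i
      refine ih (f.compContinuous ⟨childMap i, continuous_childMap i⟩) ?_ (ha.subTree i)
      intro x hx y hy hxy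
      refine hf (childMap i x) (childMap_mem_Icc i hx) (childMap i y) (childMap_mem_Icc i hy) ?_
      have h3 : (0 : ℝ) < ℓ := by exact_mod_cast i.pos
      have : childMap i x - childMap i y = (x - y) / ℓ := by simp only [childMap]; ring
      rw [this, abs_div, abs_of_pos h3, pow_succ, mul_inv, div_eq_mul_inv]
      gcongr
    choose c L hcL hc using hi
    refine ⟨fun n => ∑ i, (g (a (i, [])) : ℝ) * c i (n - 1), ∑ i, (g (a (i, [])) : ℝ) * L i,
      ?_, ?_⟩
    · refine (tendsto_add_atTop_iff_nat 1).1 ?_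
      simp only [Nat.add_sub_cancel]
      exact tendsto_finsetSum _ fun i _ => (hcL i).const_mul _
    · intro n hn
      obtain ⟨n, rfl⟩ := Nat.exists_eq_succ_of_ne_zero (by omega : n ≠ 0)
      rw [integral_genMeasure_succ]
      simp only [Nat.succ_eq_add_one, Nat.add_sub_cancel]
      rw [← Finset.sum_sub_distrib, genMass]
      push_cast
      rw [Finset.mul_sum]
      refine (Finset.abs_sum_le_sum_abs _ _).trans (Finset.sum_le_sum fun i _ => ?_)
      rw [← mul_sub, abs_mul, NNReal.abs_eq, mul_left_comm]
      gcongr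
      exact hc i n (by omega)

theorem cauchySeq_of_forall_exists_tendsto {u : ℕ → ℝ}
    (h : ∀ ε > 0, ∃ (c : ℕ → ℝ) (L : ℝ), Tendsto c atTop (𝓝 L) ∧ ∀ᶠ n in atTop, |u n - c n| ≤ ε) :
    CauchySeq u := by
  refine Metric.cauchySeq_iff'.2 fun ε hε => ?_
  obtain ⟨c, L, hc, hu⟩ := h (ε / 8) (by positivity)
  obtain ⟨N, hN⟩ := eventually_atTop.1
    (hu.and (hc.eventually (Metric.ball_mem_nhds L (show 0 < ε / 8 by positivity))))
  refine ⟨N, fun n hn => ?_⟩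
  obtain ⟨h1, h2⟩ := hN n hn
  obtain ⟨h3, h4⟩ := hN N le_rfl
  simp only [Real.dist_eq] at h2 h4 ⊢
  rw [abs_le] at h1 h3
  rw [abs_lt] at h2 h4 ⊢
  constructor <;> linarith

/-- The approximations converge weakly: their integrals against bounded continuous functions are
Cauchy sequences, and the compactness of the set of measures on `[0, 1]` of bounded mass provides a
measure with the limits as its integrals. -/
theorem Convergent.exists_tendsto_genMeasure (hℓ : 2 ≤ ℓ) {a : Tree ℓ} (ha : Convergent g a) :
    ∃ m : FiniteMeasure ℝ, Tendsto (fun n => genMeasure g n a) atTop (𝓝 m) ∧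
      (m : Measure ℝ) (Set.Icc 0 1)ᶜ = 0 := by
  obtain ⟨c, hc⟩ := ha.tendsto_genMass
  obtain ⟨B, hB⟩ := hc.bddAbove_range
  have hB' : ∀ n, genMass g n a ≤ B := fun n => hB ⟨n, rfl⟩
  have hint : ∀ f : ℝ →ᵇ ℝ, ∃ L,
      Tendsto (fun n => ∫ x, f x ∂(genMeasure g n a : Measure ℝ)) atTop (𝓝 L) := by
    intro f
    refine cauchySeq_tendsto_of_complete (cauchySeq_of_forall_exists_tendsto fun ε hε => ?_)
    have huc := isCompact_Icc.uniformContinuousOn_of_continuous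
      (f.continuous.continuousOn (s := Set.Icc (0 : ℝ) 1))
    obtain ⟨δ, hδ, hfδ⟩ := Metric.uniformContinuousOn_iff.1 huc (ε / (B + 1)) (by positivity)
    have hℓ' : (1 : ℝ) < ℓ := by exact_mod_cast hℓ
    obtain ⟨N, hN⟩ := exists_pow_lt_of_lt_one hδ (inv_lt_one_of_one_lt₀ hℓ')
    rw [inv_pow] at hN
    obtain ⟨c, L, hc, h⟩ := exists_tendsto_abs_integral_sub_le (g := g) N f
      (fun x hx y hy hxy => (hfδ x hx y hy (lt_of_le_of_lt hxy hN)).le) ha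
    refine ⟨c, L, hc, (eventually_ge_atTop N).mono fun n hn => (h n hn).trans ?_⟩
    calc ε / (B + 1) * genMass g n a ≤ ε / (B + 1) * (B + 1) := by
          gcongr
          exact (NNReal.coe_le_coe.2 (hB' n)).trans (by linarith)
      _ = ε := by field_simp
  have hK := isCompact_setOfPred_finiteMeasure_le_of_isCompact B
    (isCompact_Icc (a := (0 : ℝ)) (b := 1))
  obtain ⟨m, hm, hmc⟩ := hK.exists_mapClusterPt (f := atTop) (u := fun n => genMeasure g n a)
    (le_principal_iff.2 <| eventually_map.2 <| Eventually.of_forall fun n =>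
      ⟨(mass_genMeasure n a).trans_le (hB' n),
      (FiniteMeasure.null_iff_toMeasure_null _ _).2 (genMeasure_compl_Icc n a)⟩)
  refine ⟨m, FiniteMeasure.tendsto_of_forall_integral_tendsto fun f => ?_,
    (FiniteMeasure.null_iff_toMeasure_null _ _).1 hm.2⟩
  obtain ⟨U, hU, hUm⟩ := mapClusterPt_iff_ultrafilter.1 hmc
  obtain ⟨L, hL⟩ := hint f
  have h1 := FiniteMeasure.tendsto_iff_forall_integral_tendsto.1 hUm f
  rwa [tendsto_nhds_unique h1 (hL.mono_left hU)]

/-- The cascade measure with edge weights `g`: the weak limit of its approximations. -/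
def limMeasure (g : ℝ → ℝ≥0) (a : Tree ℓ) : FiniteMeasure ℝ :=
  limUnder atTop fun n => genMeasure g n a

theorem Convergent.tendsto_genMeasure (hℓ : 2 ≤ ℓ) {a : Tree ℓ} (ha : Convergent g a) :
    Tendsto (fun n => genMeasure g n a) atTop (𝓝 (limMeasure g a)) :=
  tendsto_nhds_limUnder ((ha.exists_tendsto_genMeasure hℓ).imp fun _ h => h.1)

theorem Convergent.limMeasure_compl_Icc (hℓ : 2 ≤ ℓ) {a : Tree ℓ} (ha : Convergent g a) :
    (limMeasure g a : Measure ℝ) (Set.Icc 0 1)ᶜ = 0 := by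
  obtain ⟨m, hm, hm0⟩ := ha.exists_tendsto_genMeasure hℓ
  rwa [tendsto_nhds_unique (ha.tendsto_genMeasure hℓ) hm]

theorem Convergent.limMeasure_univ (hℓ : 2 ≤ ℓ) {a : Tree ℓ} (ha : Convergent g a) :
    (limMeasure g a : Measure ℝ) Set.univ = limMass g a := by
  obtain ⟨c, hc⟩ := ha.tendsto_genMass
  have h := (ha.tendsto_genMeasure hℓ).mass
  simp only [mass_genMeasure] at h
  rw [limMass_eq_of_tendsto hc, ← tendsto_nhds_unique h hc, FiniteMeasure.ennreal_mass]

/-- The cascade measure is the sum of the scaled copies of the cascade measures of the first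
subtrees. -/
theorem Convergent.limMeasure_eq (hℓ : 2 ≤ ℓ) {a : Tree ℓ} (ha : Convergent g a) :
    limMeasure g a =
      ∑ i, g (a (i, [])) • (limMeasure g (CascadeTree.subTree i a)).map (childMap i) := by
  refine tendsto_nhds_unique ((tendsto_add_atTop_iff_nat 1).2 (ha.tendsto_genMeasure hℓ)) ?_
  refine tendsto_finsetSum _ fun i _ => Tendsto.const_smul ?_ _
  exact ((FiniteMeasure.continuous_map (continuous_childMap i)).tendsto _).comp
    ((ha.subTree i).tendsto_genMeasure hℓ)

theorem Convergent.limMeasure_apply (hℓ : 2 ≤ ℓ) {a : Tree ℓ} (ha : Convergent g a) {s : Set ℝ}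
    (hs : MeasurableSet s) :
    (limMeasure g a : Measure ℝ) s = ∑ i, (g (a (i, [])) : ℝ≥0∞) *
      (limMeasure g (CascadeTree.subTree i a) : Measure ℝ) (childMap i ⁻¹' s) := by
  conv_lhs => rw [ha.limMeasure_eq hℓ]
  exact toMeasure_sum_smul_map_apply _ _ hs

/-- The last letter of the alphabet. -/
def lastLetter (hℓ : 2 ≤ ℓ) : Fin ℓ := ⟨ℓ - 1, by omega⟩

/-- The point `1` lies in the closure of the cells of the words `(ℓ - 1) ⋯ (ℓ - 1)` only, so that
their masses bound its mass. -/
theorem Convergent.limMeasure_singleton_one_le (hℓ : 2 ≤ ℓ) {a : Tree ℓ} (ha : Convergent g a)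
    (k : ℕ) : (limMeasure g a : Measure ℝ) {1} ≤
      cellMass g (List.replicate k (lastLetter hℓ)) a := by
  induction k generalizing a with
  | zero =>
    rw [List.replicate_zero, cellMass_nil, ← ha.limMeasure_univ hℓ]
    exact measure_mono (Set.subset_univ _)
  | succ k ih =>
    rw [List.replicate_succ, cellMass_cons, ha.limMeasure_apply hℓ (measurableSet_singleton 1),
      Finset.sum_eq_single (lastLetter hℓ)]
    · gcongr
      refine le_trans (measure_mono fun x hx => ?_) (ih (ha.subTree _))
      have h3 : (ℓ : ℝ) ≠ 0 := by norm_cast; omega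
      have h4 : (((lastLetter hℓ : Fin ℓ) : ℕ) : ℝ) = ℓ - 1 := by
        simp [lastLetter, Nat.cast_sub (by omega : 1 ≤ ℓ)]
      simp only [Set.mem_preimage, Set.mem_singleton_iff, childMap, h4, div_eq_one_iff_eq h3] at hx
      simp only [Set.mem_singleton_iff]
      linarith
    · intro i _ hi
      rw [measure_mono_null (fun x hx hx' => ?_) ((ha.subTree i).limMeasure_compl_Icc hℓ), mul_zero]
      have h3 : (ℓ : ℝ) ≠ 0 := by norm_cast; omega
      simp only [Set.mem_preimage, Set.mem_singleton_iff, childMap, div_eq_one_iff_eq h3] at hx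
      have h5 : (i : ℕ) + 1 < ℓ := by
        have h6 : (i : ℕ) ≠ ℓ - 1 := fun h => hi (Fin.ext h)
        have := i.isLt
        omega
      have h6 : ((i : ℕ) : ℝ) + 1 < ℓ := by exact_mod_cast h5
      linarith [hx'.2]
    · simp

/-! ### Cells -/

/-- The cell of a word, defined from the first letter down. -/
def cell : List (Fin ℓ) → Set ℝ
  | [] => Set.Ico 0 1
  | i :: w => {x | ℓ * x - i ∈ cell w}

theorem cell_subset_Ico (w : List (Fin ℓ)) : cell w ⊆ Set.Ico 0 1 := by
  induction w with
  | nil => exact subset_rfl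
  | cons i w ih =>
    intro x hx
    obtain ⟨h1, h2⟩ := ih hx
    have h3 : ((i : ℕ) : ℝ) + 1 ≤ ℓ := by exact_mod_cast i.isLt
    have h4 : (0 : ℝ) ≤ (i : ℕ) := by positivity
    have h5 : (0 : ℝ) < ℓ := by linarith
    constructor
    · by_contra h; push Not at h; nlinarith
    · by_contra h; push Not at h; nlinarith

theorem measurableSet_cell (w : List (Fin ℓ)) : MeasurableSet (cell w) := by
  induction w with
  | nil => exact measurableSet_Ico
  | cons i w ih =>
    exact (by fun_prop : Measurable fun x : ℝ => (ℓ : ℝ) * x - (i : ℕ)) ih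

theorem eq_of_add_mem_Ico {i j : Fin ℓ} {x : ℝ} (hx : x ∈ Set.Ico (0 : ℝ) 1)
    (h : x + i - j ∈ Set.Ico (0 : ℝ) 1) : i = j := by
  have h1 : ((i : ℕ) : ℝ) < (j : ℕ) + 1 := by linarith [hx.1, h.2]
  have h2 : ((j : ℕ) : ℝ) < (i : ℕ) + 1 := by linarith [hx.2, h.1]
  norm_cast at h1 h2
  exact Fin.ext (by omega)

/-- The cascade measures of the tree and of all its subtrees do not charge the point `1`, at which
adjacent cells meet. -/
def NoEndMass (g : ℝ → ℝ≥0) (a : Tree ℓ) : Prop :=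
  ∀ w, (limMeasure g (subTreeAt w a) : Measure ℝ) {1} = 0

theorem limMeasure_compl_Ico (hℓ : 2 ≤ ℓ) {a : Tree ℓ} (ha : Convergent g a)
    (h1 : NoEndMass g a) : (limMeasure g a : Measure ℝ) (Set.Ico 0 1)ᶜ = 0 := by
  refine measure_mono_null (t := (Set.Icc 0 1)ᶜ ∪ {1}) (fun x hx => ?_)
    (measure_union_null (ha.limMeasure_compl_Icc hℓ) (h1 []))
  by_contra h
  simp only [Set.mem_union, Set.mem_compl_iff, Set.mem_singleton_iff, not_or, not_not] at h
  exact hx ⟨h.1.1, lt_of_le_of_ne h.1.2 h.2⟩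

theorem limMeasure_cell (hℓ : 2 ≤ ℓ) {a : Tree ℓ} (ha : Convergent g a) (h1 : NoEndMass g a)
    (w : List (Fin ℓ)) : (limMeasure g a : Measure ℝ) (cell w) = cellMass g w a := by
  induction w generalizing a with
  | nil =>
    have := measure_inter_add_sdiff (μ := (limMeasure g a : Measure ℝ)) Set.univ
      (measurableSet_Ico (a := (0 : ℝ)) (b := 1))
    rw [← Set.compl_eq_univ_sdiff, limMeasure_compl_Ico hℓ ha h1, Set.univ_inter, add_zero] at this
    rw [cell, this, cellMass_nil, ha.limMeasure_univ hℓ]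
  | cons i w ih =>
    have h3 : (ℓ : ℝ) ≠ 0 := by norm_cast; omega
    have hpre : ∀ j : Fin ℓ, childMap j ⁻¹' cell (i :: w) = {x : ℝ | x + j - i ∈ cell w} :=
        fun j => by
      ext x
      simp only [cell, Set.mem_preimage, Set.mem_ofPred_eq, childMap]
      rw [mul_div_cancel₀ _ h3]
    rw [ha.limMeasure_apply hℓ (measurableSet_cell _), Finset.sum_eq_single i, cellMass_cons,
      ← ih (ha.subTree i) (fun w => h1 (i :: w)), hpre]
    · simp
    · intro j _ hj
      have hsub : {x : ℝ | x + j - i ∈ cell w} ⊆ (Set.Ico 0 1)ᶜ :=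
        fun x hx hx' => hj (eq_of_add_mem_Ico hx' (cell_subset_Ico w hx))
      have h0 := limMeasure_compl_Ico hℓ (ha.subTree j) fun w => h1 (j :: w)
      rw [hpre, measure_mono_null hsub h0, mul_zero]
    · simp

/-! ### Almost sure regularity -/

variable {ν : Measure ℝ} [IsProbabilityMeasure ν]

theorem ae_convergent (hg : Measurable g) (hcrit : (ℓ : ℝ≥0∞) * ∫⁻ x, g x ∂ν = 1) :
    ∀ᵐ a ∂treeLaw ℓ ν, Convergent g a :=
  ae_forall_subTreeAt (ae_tendsto_genMass hg hcrit)

theorem ae_iInf_cellMass_replicate_eq_zero (hℓ : 2 ≤ ℓ) (hg : Measurable g)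
    (hcrit : (ℓ : ℝ≥0∞) * ∫⁻ x, g x ∂ν = 1) (i : Fin ℓ) :
    ∀ᵐ a ∂treeLaw ℓ ν, ⨅ k, cellMass g (List.replicate k i) a = 0 := by
  have hg1 : ∫⁻ x, g x ∂ν < 1 := by
    rw [mul_comm] at hcrit
    rw [ENNReal.eq_inv_of_mul_eq_one_left hcrit, ENNReal.inv_lt_one]
    exact_mod_cast hℓ
  have hm : ∀ k, Measurable fun a : Tree ℓ => cellMass g (List.replicate k i) a := fun k =>
    measurable_cellMass hg _
  refine (lintegral_eq_zero_iff (Measurable.iInf hm)).1 (le_antisymm ?_ zero_le)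
  refine ge_of_tendsto' (ENNReal.tendsto_pow_atTop_nhds_zero_of_lt_one hg1) fun k => ?_
  calc ∫⁻ a, ⨅ k, cellMass g (List.replicate k i) a ∂treeLaw ℓ ν
      ≤ ∫⁻ a, cellMass g (List.replicate k i) a ∂treeLaw ℓ ν :=
        lintegral_mono fun a => iInf_le _ k
    _ = (∫⁻ x, g x ∂ν) ^ k * ∫⁻ a, limMass g a ∂treeLaw ℓ ν := by
        simp only [cellMass]
        rw [lintegral_pathWeight_mul hg _ (measurable_limMass hg), List.length_replicate]
    _ ≤ (∫⁻ x, g x ∂ν) ^ k * 1 := by gcongr; exact lintegral_limMass_le_one hg hcrit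
    _ = _ := mul_one _

theorem ae_noEndMass (hℓ : 2 ≤ ℓ) (hg : Measurable g)
    (hcrit : (ℓ : ℝ≥0∞) * ∫⁻ x, g x ∂ν = 1) : ∀ᵐ a ∂treeLaw ℓ ν, NoEndMass g a := by
  refine ae_forall_subTreeAt (p := fun a => (limMeasure g a : Measure ℝ) {1} = 0) ?_
  filter_upwards [ae_convergent hg hcrit,
    ae_iInf_cellMass_replicate_eq_zero hℓ hg hcrit (lastLetter hℓ)] with a ha h0
  exact le_antisymm (h0 ▸ le_iInf fun k => ha.limMeasure_singleton_one_le hℓ k) zero_le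

end

/-! ### The `ℓ`-adic grid -/

section

variable {ℓ : ℕ}

/-- The interval of the form `[k / ℓ ^ n, (k + 1) / ℓ ^ n)` with `k` an integer that contains the
real number `x`. -/
def gridCell (ℓ n : ℕ) (x : ℝ) : Set ℝ := {y | ⌊(ℓ : ℝ) ^ n * y⌋ = ⌊(ℓ : ℝ) ^ n * x⌋}

theorem exists_mem_cell_iff_floor_eq (w : List (Fin ℓ)) :
    ∃ N : ℤ, ∀ x : ℝ, x ∈ cell w ↔ ⌊(ℓ : ℝ) ^ w.length * x⌋ = N := by
  induction w with
  | nil => exact ⟨0, fun x => by simp [cell, Int.floor_eq_zero_iff]⟩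
  | cons i w ih =>
    obtain ⟨N, hN⟩ := ih
    refine ⟨N + ((ℓ ^ w.length * i : ℕ) : ℤ), fun x => ?_⟩
    have h : (ℓ : ℝ) ^ w.length * (ℓ * x - (i : ℕ))
        = (ℓ : ℝ) ^ (i :: w).length * x - ((ℓ ^ w.length * i : ℕ) : ℤ) := by
      push_cast [List.length_cons]
      ring
    rw [cell, Set.mem_ofPred_eq, hN, h, Int.floor_sub_intCast, sub_eq_iff_eq_add]

theorem cell_eq_gridCell {w : List (Fin ℓ)} {n : ℕ} (hw : w.length = n) {x : ℝ} (hx : x ∈ cell w) :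
    cell w = gridCell ℓ n x := by
  subst hw
  obtain ⟨N, hN⟩ := exists_mem_cell_iff_floor_eq w
  ext y
  rw [hN, gridCell, Set.mem_ofPred_eq, (hN x).1 hx]

theorem exists_mem_cell (hℓ : ℓ ≠ 0) (n : ℕ) {x : ℝ} (hx : x ∈ Set.Ico (0 : ℝ) 1) :
    ∃ ε : Fin n → Fin ℓ, x ∈ cell (List.ofFn ε) := by
  induction n generalizing x with
  | zero => exact ⟨Fin.elim0, by simpa [cell] using hx⟩
  | succ n ih =>
    have hℓ' : (0 : ℝ) < ℓ := by positivity
    have h0 : (0 : ℝ) ≤ ℓ * x := mul_nonneg hℓ'.le hx.1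
    have hi : ⌊(ℓ : ℝ) * x⌋₊ < ℓ := (Nat.floor_lt h0).2 (by nlinarith [hx.2])
    obtain ⟨ε, hε⟩ := ih (x := ℓ * x - ⌊(ℓ : ℝ) * x⌋₊)
      ⟨sub_nonneg.2 (Nat.floor_le h0), by linarith [Nat.lt_floor_add_one ((ℓ : ℝ) * x)]⟩
    exact ⟨Fin.cons ⟨_, hi⟩ ε, by rw [List.ofFn_cons]; exact hε⟩

theorem adicInterval_eq_cell {n : ℕ} (hℓ : ℓ ≠ 0) (ε : Fin n → Fin ℓ) :
    Mandelbrot.adicInterval ε = cell (List.ofFn ε) := by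
  have hℓ' : (0 : ℝ) < ℓ := by positivity
  induction n with
  | zero => simp [Mandelbrot.adicInterval, cell]
  | succ n ih =>
    rw [List.ofFn_succ, cell, ← ih]
    ext x
    have h : ∑ k : Fin n, ((ε k.succ : ℕ) : ℝ) / (ℓ : ℝ) ^ (((k.succ : Fin (n + 1)) : ℕ) + 1)
        = (∑ k : Fin n, ((ε k.succ : ℕ) : ℝ) / (ℓ : ℝ) ^ ((k : ℕ) + 1)) / ℓ := by
      rw [Finset.sum_div]
      refine Finset.sum_congr rfl fun k _ => ?_
      rw [Fin.val_succ, pow_succ, div_div]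
    rw [Mandelbrot.adicInterval, Fin.sum_univ_succ, h, Mandelbrot.adicInterval, Set.mem_ofPred_eq,
      Set.mem_Ico, Set.mem_Ico]
    set s := ∑ k : Fin n, ((ε k.succ : ℕ) : ℝ) / (ℓ : ℝ) ^ ((k : ℕ) + 1)
    have h1 : ((ε 0 : ℕ) : ℝ) / (ℓ : ℝ) ^ (((0 : Fin (n + 1)) : ℕ) + 1) + s / ℓ =
        (s + ε 0) / ℓ := by
      simp; ring
    have h2 : (s + ε 0) / ℓ + 1 / (ℓ : ℝ) ^ (n + 1) = (s + 1 / (ℓ : ℝ) ^ n + ε 0) / ℓ := by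
      rw [pow_succ]; field_simp; ring
    rw [h1, h2, div_le_iff₀ hℓ', lt_div_iff₀ hℓ']
    constructor
    · rintro ⟨h3, h4⟩; constructor <;> linarith
    · rintro ⟨h3, h4⟩; constructor <;> linarith

theorem adicIntervalAt_eq_gridCell (hℓ : ℓ ≠ 0) (n : ℕ) {x : ℝ} (hx : x ∈ Set.Ico (0 : ℝ) 1) :
    Mandelbrot.adicIntervalAt ℓ n x = gridCell ℓ n x := by
  obtain ⟨ε, hε⟩ := exists_mem_cell hℓ n hx
  simp only [Mandelbrot.adicIntervalAt, adicInterval_eq_cell hℓ]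
  refine Set.Subset.antisymm (Set.iUnion₂_subset fun ε' hε' => ?_) ?_
  · rw [cell_eq_gridCell List.length_ofFn hε']
  · rw [← cell_eq_gridCell List.length_ofFn hε]
    exact Set.subset_iUnion₂_of_subset ε hε subset_rfl

theorem measurable_gridCell {Φ : Set ℝ → ℝ≥0∞} (n : ℕ) :
    Measurable fun x => Φ (gridCell ℓ n x) := by
  have h : Measurable fun k : ℤ => Φ {y | ⌊(ℓ : ℝ) ^ n * y⌋ = k} := measurable_from_top
  exact h.comp (Int.measurable_floor.comp (measurable_const_mul _))

theorem volume_gridCell (hℓ : ℓ ≠ 0) (n : ℕ) (x : ℝ) :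
    volume.real (gridCell ℓ n x) = ((ℓ : ℝ) ^ n)⁻¹ := by
  have h0 : (0 : ℝ) < (ℓ : ℝ) ^ n := by positivity
  have h : gridCell ℓ n x =
      Set.Ico (⌊(ℓ : ℝ) ^ n * x⌋ / (ℓ : ℝ) ^ n) ((⌊(ℓ : ℝ) ^ n * x⌋ + 1) / (ℓ : ℝ) ^ n) := by
    ext y
    rw [gridCell, Set.mem_ofPred_eq, Int.floor_eq_iff, Set.mem_Ico, div_le_iff₀ h0, lt_div_iff₀ h0,
      mul_comm y]
  rw [h, Real.volume_real_Ico_of_le (by gcongr; linarith)]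
  field_simp
  ring

/-- A sum over cells bounds the integral of a function of the cell. -/
theorem lintegral_gridCell_le (hℓ : ℓ ≠ 0) {N : Measure ℝ} (hN : N (Set.Ico 0 1)ᶜ = 0)
    (Φ : Set ℝ → ℝ≥0∞) (n : ℕ) :
    ∫⁻ x, Φ (gridCell ℓ n x) ∂N
      ≤ ∑ ε : Fin n → Fin ℓ, N (cell (List.ofFn ε)) * Φ (cell (List.ofFn ε)) := by
  have hcov : ∀ᵐ x ∂N, x ∈ Set.Ico (0 : ℝ) 1 := by
    filter_upwards [measure_eq_zero_iff_ae_notMem.1 hN] with x hx using not_not.1 hx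
  calc ∫⁻ x, Φ (gridCell ℓ n x) ∂N
      ≤ ∫⁻ x, ∑ ε : Fin n → Fin ℓ,
          (cell (List.ofFn ε)).indicator (fun _ => Φ (cell (List.ofFn ε))) x ∂N := by
        refine lintegral_mono_ae ?_
        filter_upwards [hcov] with x hx
        obtain ⟨ε, hε⟩ := exists_mem_cell hℓ n hx
        refine le_trans ?_ (Finset.single_le_sum (f := fun ε : Fin n → Fin ℓ =>
          (cell (List.ofFn ε)).indicator (fun _ => Φ (cell (List.ofFn ε))) x)
          (fun _ _ => zero_le) (Finset.mem_univ ε))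
        rw [Set.indicator_of_mem hε, cell_eq_gridCell List.length_ofFn hε]
    _ = _ := by
        rw [lintegral_finsetSum _ fun ε _ => measurable_const.indicator (measurableSet_cell _)]
        refine Finset.sum_congr rfl fun ε _ => ?_
        rw [lintegral_indicator_const (measurableSet_cell _), mul_comm]

/-- The factor `ℓ ^ (n c)` that compares the mass of a cell of the generation `n` with the power
`c` of its length. -/
def scale (ℓ : ℕ) (c : ℝ) (n : ℕ) : ℝ≥0∞ := ENNReal.ofReal ((ℓ : ℝ) ^ (n * c))

theorem scale_ne_zero (hℓ : ℓ ≠ 0) (c : ℝ) (n : ℕ) : scale ℓ c n ≠ 0 := by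
  rw [scale, ENNReal.ofReal_ne_zero_iff]; positivity

/-- If the sum over all cells of `N(I) (m(I) / |I| ^ c) ^ s` is finite, then, at `N`-almost every
point, the ratio `m(I) / |I| ^ c` is eventually at most one for `s > 0`, and at least one for
`s < 0`. -/
theorem ae_eventually_rpow_le_one (hℓ : ℓ ≠ 0) {N : Measure ℝ} (hN : N (Set.Ico 0 1)ᶜ = 0)
    (m : Measure ℝ) (c s : ℝ)
    (h : ∑' n : ℕ, ∑ ε : Fin n → Fin ℓ, N (cell (List.ofFn ε)) *
      (m (cell (List.ofFn ε)) * scale ℓ c n) ^ s ≠ ∞) :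
    ∀ᵐ x ∂N, ∀ᶠ n in atTop, (m (gridCell ℓ n x) * scale ℓ c n) ^ s ≤ 1 := by
  have hmeas : ∀ n, Measurable fun x => (m (gridCell ℓ n x) * scale ℓ c n) ^ s := fun n =>
    measurable_gridCell (Φ := fun I => (m I * scale ℓ c n) ^ s) n
  have hint : ∫⁻ x, ∑' n : ℕ, (m (gridCell ℓ n x) * scale ℓ c n) ^ s ∂N ≠ ∞ := by
    rw [lintegral_tsum fun n => (hmeas n).aemeasurable]
    refine ne_top_of_le_ne_top h (ENNReal.tsum_le_tsum fun n => ?_)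
    exact lintegral_gridCell_le hℓ hN (fun I => (m I * scale ℓ c n) ^ s) n
  filter_upwards [ae_lt_top (Measurable.tsum hmeas) hint] with x hx
  have := ENNReal.tendsto_atTop_zero_of_tsum_ne_top hx.ne
  exact this.eventually_le_const one_pos

/-! ### The mass distribution principle on the grid -/

theorem floor_mem_of_abs_sub_le {x y : ℝ} (h : |x - y| ≤ 1) :
    ⌊x⌋ = ⌊y⌋ - 1 ∨ ⌊x⌋ = ⌊y⌋ ∨ ⌊x⌋ = ⌊y⌋ + 1 := by
  rw [abs_le] at h
  have h1 : ⌊x⌋ ≤ ⌊y⌋ + 1 := by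
    rw [← Int.floor_add_one]; exact Int.floor_le_floor (by linarith)
  have h2 : ⌊y⌋ ≤ ⌊x⌋ + 1 := by
    rw [← Int.floor_add_one]; exact Int.floor_le_floor (by linarith)
  omega

/-- A set of diameter at most `ℓ ^ (-n)` meets at most three cells of the generation `n`. -/
theorem measure_le_three_mul (hℓ : ℓ ≠ 0) {N : Measure ℝ} {S : Set ℝ} {n : ℕ} {b : ℝ≥0∞}
    (hS : ∀ x ∈ S, ∀ y ∈ S, |x - y| ≤ ((ℓ : ℝ) ^ n)⁻¹) (hb : ∀ x ∈ S, N (gridCell ℓ n x) ≤ b) :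
    N S ≤ 3 * b := by
  rcases S.eq_empty_or_nonempty with rfl | ⟨x₀, hx₀⟩
  · simp
  have h0 : (0 : ℝ) < (ℓ : ℝ) ^ n := by positivity
  set f : ℝ → ℤ := fun x => ⌊(ℓ : ℝ) ^ n * x⌋ with hf
  have hpiece : ∀ k : ℤ, N (S ∩ f ⁻¹' {k}) ≤ b := by
    intro k
    rcases (S ∩ f ⁻¹' {k}).eq_empty_or_nonempty with h | ⟨y, hyS, hy⟩
    · simp [h]
    · refine (measure_mono fun z hz => ?_).trans (hb y hyS)
      exact (Set.mem_singleton_iff.1 hz.2).trans (Set.mem_singleton_iff.1 hy).symm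
  have hcov : S ⊆ (S ∩ f ⁻¹' {f x₀ - 1}) ∪ (S ∩ f ⁻¹' {f x₀}) ∪ (S ∩ f ⁻¹' {f x₀ + 1}) := by
    intro y hy
    have h1 : |(ℓ : ℝ) ^ n * y - (ℓ : ℝ) ^ n * x₀| ≤ 1 := by
      rw [← mul_sub, abs_mul, abs_of_pos h0]
      calc (ℓ : ℝ) ^ n * |y - x₀| ≤ (ℓ : ℝ) ^ n * ((ℓ : ℝ) ^ n)⁻¹ := by gcongr; exact hS y hy x₀ hx₀
        _ = 1 := mul_inv_cancel₀ h0.ne'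
    rcases floor_mem_of_abs_sub_le h1 with h | h | h
    · exact Or.inl (Or.inl ⟨hy, h⟩)
    · exact Or.inl (Or.inr ⟨hy, h⟩)
    · exact Or.inr ⟨hy, h⟩
  calc N S ≤ _ := measure_mono hcov
    _ ≤ N (S ∩ f ⁻¹' {f x₀ - 1}) + N (S ∩ f ⁻¹' {f x₀}) + N (S ∩ f ⁻¹' {f x₀ + 1}) :=
      (measure_union_le _ _).trans (by gcongr; exact measure_union_le _ _)
    _ ≤ b + b + b := by gcongr <;> exact hpiece _
    _ = 3 * b := by ring

/-- If, at almost every point of `E` for a nonzero measure carried by `E`, the mass of the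
`ℓ`-adic cell is eventually at most the power `c` of its length, then `E` has Hausdorff dimension
at least `c`. -/
theorem ofReal_le_dimH (hℓ : 2 ≤ ℓ) {N : Measure ℝ} (hN0 : N Set.univ ≠ 0) {E : Set ℝ} {c : ℝ}
    (hc : 0 < c) (hE : ∀ᵐ x ∂N, x ∈ E)
    (h : ∀ᵐ x ∂N, ∀ᶠ n in atTop, N (gridCell ℓ n x) * scale ℓ c n ≤ 1) :
    ENNReal.ofReal c ≤ dimH E := by
  have hℓ0 : ℓ ≠ 0 := by omega
  have hℓ1 : (1 : ℝ) < ℓ := by exact_mod_cast hℓ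
  set F : ℕ → Set ℝ := fun k => {x | ∀ n, k ≤ n → N (gridCell ℓ n x) * scale ℓ c n ≤ 1} with hF
  have hFm : ∀ k, MeasurableSet (F k) := fun k => by
    simp only [hF, Set.ofPred_forall]
    exact MeasurableSet.iInter fun n => MeasurableSet.iInter fun _ =>
      measurableSet_le (measurable_gridCell (Φ := fun I => N I * scale ℓ c n) n) measurable_const
  obtain ⟨k, hk⟩ : ∃ k, N (F k) ≠ 0 := by
    by_contra hcon
    push Not at hcon
    refine hN0 (measure_mono_null (t := (⋃ k, F k) ∪ (⋃ k, F k)ᶜ) (by rw [Set.union_compl_self])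
      (measure_union_null (measure_iUnion_null hcon) ?_))
    refine measure_mono_null (fun x hx => ?_) (ae_iff.1 h)
    intro hx'
    obtain ⟨k, hk⟩ := eventually_atTop.1 hx'
    exact hx (Set.mem_iUnion.2 ⟨k, hk⟩)
  set μ : Measure ℝ := N.restrict (F k) with hμ
  set C : ℝ≥0∞ := 3 * ENNReal.ofReal ((ℓ : ℝ) ^ c) with hC
  have hC0 : C ≠ 0 := mul_ne_zero (by norm_num) (ENNReal.ofReal_ne_zero_iff.2 (by positivity))
  have hCt : C ≠ ∞ := by finiteness
  have hcellF : ∀ n, k ≤ n → ∀ x ∈ F k,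
      N (gridCell ℓ n x) ≤ ENNReal.ofReal (((ℓ : ℝ) ^ (n * c))⁻¹) := by
    intro n hn x hx
    rw [ENNReal.ofReal_inv_of_pos (by positivity)]
    exact ENNReal.le_inv_iff_mul_le.2 (hx n hn)
  have hbound : ∀ S : Set ℝ, Metric.ediam S ≤ ENNReal.ofReal (((ℓ : ℝ) ^ k)⁻¹) →
      μ S ≤ C * Metric.ediam S ^ c := by
    intro S hS
    rw [hμ, Measure.restrict_apply' (hFm k)]
    set d := Metric.ediam S with hd
    have hdt : d ≠ ∞ := ne_top_of_le_ne_top ENNReal.ofReal_ne_top hS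
    have hdist : ∀ x ∈ S, ∀ y ∈ S, |x - y| ≤ d.toReal := fun x hx y hy => by
      rw [← Real.dist_eq, dist_edist]
      exact ENNReal.toReal_mono hdt (Metric.edist_le_ediam_of_mem hx hy)
    have hdk : d.toReal ≤ ((ℓ : ℝ) ^ k)⁻¹ := ENNReal.toReal_le_of_le_ofReal (by positivity) hS
    have hn : ∀ n, k ≤ n → d.toReal ≤ ((ℓ : ℝ) ^ n)⁻¹ →
        N (S ∩ F k) ≤ 3 * ENNReal.ofReal (((ℓ : ℝ) ^ (n * c))⁻¹) := fun n hkn hdn =>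
      measure_le_three_mul hℓ0 (fun x hx y hy => (hdist x hx.1 y hy.1).trans hdn)
        fun x hx => hcellF n hkn x hx.2
    rcases eq_or_ne d 0 with hd0 | hd0
    · -- sets of zero diameter are controlled by cells of every generation
      have hlim : Tendsto (fun n : ℕ => 3 * ENNReal.ofReal (((ℓ : ℝ) ^ (n * c))⁻¹)) atTop
          (𝓝 (3 * ENNReal.ofReal 0)) := by
        refine ENNReal.Tendsto.const_mul (ENNReal.tendsto_ofReal ?_) (Or.inr (by finiteness))
        have h1 : ∀ n : ℕ, ((ℓ : ℝ) ^ (n * c))⁻¹ = (((ℓ : ℝ) ^ c)⁻¹) ^ n := fun n => by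
          rw [mul_comm, Real.rpow_mul (by positivity), Real.rpow_natCast, inv_pow]
        simp_rw [h1]
        exact tendsto_pow_atTop_nhds_zero_of_lt_one (by positivity)
          (inv_lt_one_of_one_lt₀ (Real.one_lt_rpow hℓ1 hc))
      rw [ENNReal.ofReal_zero, mul_zero] at hlim
      refine (ge_of_tendsto hlim ((eventually_ge_atTop k).mono fun n hkn => hn n hkn ?_)).trans
        zero_le
      rw [hd0, ENNReal.toReal_zero]
      positivity
    · have hdpos : 0 < d.toReal := ENNReal.toReal_pos hd0 hdt
      obtain ⟨n, hn1, hn2⟩ := exists_nat_pow_near_of_lt_one hdpos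
        (hdk.trans (inv_le_one_of_one_le₀ (one_le_pow₀ hℓ1.le))) (inv_pos.2 (by positivity))
        (inv_lt_one_of_one_lt₀ hℓ1)
      rw [inv_pow] at hn1 hn2
      have hkn : k ≤ n := by
        have h1 := hn1.trans_le hdk
        rw [inv_lt_inv₀ (by positivity) (by positivity)] at h1
        have := (pow_lt_pow_iff_right₀ hℓ1).1 h1
        omega
      refine (hn n hkn hn2).trans ?_
      rw [hC, mul_assoc, ← ENNReal.ofReal_toReal hdt, ENNReal.ofReal_rpow_of_pos hdpos,
        ← ENNReal.ofReal_mul (by positivity)]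
      gcongr
      have h2 : ((ℓ : ℝ) ^ (n * c))⁻¹ = (ℓ : ℝ) ^ c * (((ℓ : ℝ) ^ (n + 1))⁻¹) ^ c := by
        rw [Real.inv_rpow (by positivity), ← Real.rpow_natCast, ← Real.rpow_mul (by positivity),
          ← div_eq_mul_inv, ← Real.rpow_sub (by positivity), ← Real.rpow_neg (by positivity)]
        congr 1
        push_cast
        ring
      rw [h2]
      gcongr
  have hle : C⁻¹ • μ ≤ μH[c] := by
    refine Measure.le_hausdorffMeasure c _ (ENNReal.ofReal (((ℓ : ℝ) ^ k)⁻¹))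
      (ENNReal.ofReal_pos.2 (by positivity)) fun S hS => ?_
    rw [Measure.smul_apply, smul_eq_mul]
    calc C⁻¹ * μ S ≤ C⁻¹ * (C * Metric.ediam S ^ c) := by gcongr; exact hbound S hS
      _ = Metric.ediam S ^ c := by rw [← mul_assoc, ENNReal.inv_mul_cancel hC0 hCt, one_mul]
  have hμE : μ E = N (F k) := by
    have : E =ᵐ[μ] Set.univ := eventuallyEq_univ.2 (ae_restrict_of_ae hE)
    rw [measure_congr this, hμ, Measure.restrict_apply_univ]
  have hH : μH[c] E ≠ 0 := by
    have h1 := hle E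
    rw [Measure.smul_apply, smul_eq_mul, hμE] at h1
    exact (lt_of_lt_of_le (ENNReal.mul_pos (ENNReal.inv_ne_zero.2 hCt) hk) h1).ne'
  have := le_dimH_of_hausdorffMeasure_ne_zero (d := c.toNNReal) (s := E)
    (by rwa [Real.coe_toNNReal c hc.le])
  exact this

end

/-! ### The density and the level sets in terms of the tree -/

section

variable {ℓ : ℕ}

theorem density_succ (hℓ : ℓ ≠ 0) {Ω : Type*} (W : List (Fin ℓ) → Ω → ℝ) (n : ℕ) (ω : Ω) (x : ℝ) :
    Mandelbrot.density W (n + 1) ω x =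
      ∑ i, W [i] ω * Mandelbrot.density (fun v => W (i :: v)) n ω (ℓ * x - i) := by
  simp only [Mandelbrot.density]
  rw [sum_cons]
  refine Finset.sum_congr rfl fun i _ => ?_
  rw [Finset.mul_sum]
  refine Finset.sum_congr rfl fun ε _ => ?_
  have hmem : x ∈ Mandelbrot.adicInterval (Fin.cons i ε : Fin (n + 1) → Fin ℓ) ↔
      (ℓ : ℝ) * x - i ∈ Mandelbrot.adicInterval ε := by
    rw [adicInterval_eq_cell hℓ, adicInterval_eq_cell hℓ, List.ofFn_cons]
    rfl
  by_cases hx : (ℓ : ℝ) * x - i ∈ Mandelbrot.adicInterval ε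
  · rw [Set.indicator_of_mem (hmem.2 hx), Set.indicator_of_mem hx, Fin.prod_univ_succ,
      List.ofFn_cons]
    simp
  · rw [Set.indicator_of_notMem (mt hmem.1 hx), Set.indicator_of_notMem hx, mul_zero]

theorem density_nonneg {Ω : Type*} {W : List (Fin ℓ) → Ω → ℝ} {ω : Ω}
    (hW : ∀ i v, 0 ≤ W (i :: v) ω) (n : ℕ) (x : ℝ) : 0 ≤ Mandelbrot.density W n ω x := by
  refine Finset.sum_nonneg fun ε _ => Set.indicator_nonneg (fun _ _ => ?_) x
  refine Finset.prod_nonneg fun k _ => ?_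
  obtain ⟨n, rfl⟩ := Nat.exists_eq_succ_of_ne_zero (Nat.pos_iff_ne_zero.1 (k.pos))
  rw [List.ofFn_succ, List.take_succ_cons]
  exact hW _ _

theorem measurable_density {Ω : Type*} (W : List (Fin ℓ) → Ω → ℝ) (n : ℕ) (ω : Ω) :
    Measurable (Mandelbrot.density W n ω) :=
  Finset.measurable_fun_sum _ fun _ _ => measurable_const.indicator measurableSet_Ico

theorem approxMeasure_eq_withDensity (hℓ : ℓ ≠ 0) {Ω : Type*} (W : List (Fin ℓ) → Ω → ℝ) (n : ℕ)
    (ω : Ω) : Mandelbrot.approxMeasure W n ω =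
      volume.withDensity fun x => ENNReal.ofReal (Mandelbrot.density W n ω x) := by
  rw [Mandelbrot.approxMeasure, ← withDensity_indicator measurableSet_Icc]
  congr 1
  refine Set.indicator_eq_self.2 fun x hx => ?_
  by_contra hx'
  refine hx ?_
  have : Mandelbrot.density W n ω x = 0 := by
    refine Finset.sum_eq_zero fun ε _ => Set.indicator_of_notMem (fun h => hx' ?_) _
    rw [adicInterval_eq_cell hℓ] at h
    exact Set.Ico_subset_Icc_self (cell_subset_Ico _ h)
  simp [this]

theorem lintegral_comp_mul_sub (hℓ : ℓ ≠ 0) {f : ℝ → ℝ≥0∞} (hf : Measurable f) (b : ℝ) :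
    ∫⁻ x, f (ℓ * x - b) = (ℓ : ℝ≥0∞)⁻¹ * ∫⁻ x, f x := by
  have h0 : (ℓ : ℝ) ≠ 0 := by exact_mod_cast hℓ
  have h := lintegral_map (μ := (volume : Measure ℝ)) (f := fun y => f (y - b))
    (g := fun x : ℝ => (ℓ : ℝ) * x) (by fun_prop) (by fun_prop)
  rw [← h, Real.map_volume_mul_left h0, lintegral_smul_measure, lintegral_sub_right_eq_self,
    smul_eq_mul, abs_of_nonneg (by positivity), ENNReal.ofReal_inv_of_pos (by positivity),
    ENNReal.ofReal_natCast]

/-- If the weights of the cascade are `ℓ` times the edge weights `g` of the tree `a`, the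
approximations of the two constructions coincide. -/
theorem approx_eq_genMeasure (hℓ : ℓ ≠ 0) {Ω : Type*} {W : List (Fin ℓ) → Ω → ℝ} {ω : Ω}
    {g : ℝ → ℝ≥0} {a : Tree ℓ} (h : ∀ i v, W (i :: v) ω = ℓ * g (a (i, v))) (n : ℕ) :
    Mandelbrot.approx W n ω = genMeasure g n a := by
  refine FiniteMeasure.toMeasure_injective ?_
  change Mandelbrot.approxMeasure W n ω = _
  rw [approxMeasure_eq_withDensity hℓ]
  induction n generalizing W a with
  | zero =>
    have : (fun x => ENNReal.ofReal (Mandelbrot.density W 0 ω x))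
        = (Set.Ico (0 : ℝ) 1).indicator 1 := by
      ext x
      by_cases hx : x ∈ Set.Ico (0 : ℝ) 1 <;>
        simp [Mandelbrot.density, Mandelbrot.adicInterval, hx]
    rw [this, withDensity_indicator measurableSet_Ico, withDensity_one]
    rfl
  | succ n ih =>
    ext s hs
    rw [genMeasure, toMeasure_sum_smul_map_apply _ _ hs, withDensity_apply _ hs]
    have hnn : ∀ i v, 0 ≤ W (i :: v) ω := fun i v => by rw [h]; positivity
    have h1 : ∀ x, ENNReal.ofReal (Mandelbrot.density W (n + 1) ω x) = ∑ i, (ℓ : ℝ≥0∞) *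
        (g (a (i, [])) *
          ENNReal.ofReal (Mandelbrot.density (fun v => W (i :: v)) n ω (ℓ * x - i))) := by
      intro x
      rw [density_succ hℓ, ENNReal.ofReal_sum_of_nonneg]
      · refine Finset.sum_congr rfl fun i _ => ?_
        rw [ENNReal.ofReal_mul (hnn i []), h, ENNReal.ofReal_mul (by positivity),
          ENNReal.ofReal_natCast, ENNReal.ofReal_coe_nnreal, mul_assoc]
      · exact fun i _ => mul_nonneg (hnn i []) (density_nonneg (fun j v => hnn i (j :: v)) n _)
    have hm : ∀ i : Fin ℓ, Measurable fun x =>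
        ENNReal.ofReal (Mandelbrot.density (fun v => W (i :: v)) n ω x) := fun i =>
      (measurable_density _ n ω).ennreal_ofReal
    have hℓ' : (ℓ : ℝ) ≠ 0 := by exact_mod_cast hℓ
    simp_rw [h1]
    rw [lintegral_finsetSum]
    · refine Finset.sum_congr rfl fun i _ => ?_
      have hpre : MeasurableSet (childMap i ⁻¹' s) := (continuous_childMap i).measurable hs
      rw [lintegral_const_mul, lintegral_const_mul,
        ← ih (W := fun v => W (i :: v)) (fun j v => by rw [h]; rfl), withDensity_apply _ hpre,
        ← lintegral_indicator hpre, ← lintegral_indicator hs, mul_left_comm]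
      · congr 1
        have h2 := lintegral_comp_mul_sub hℓ ((hm i).indicator hpre) ((i : ℕ) : ℝ)
        have h3 : ∀ x : ℝ, (childMap i ⁻¹' s).indicator (fun x =>
            ENNReal.ofReal (Mandelbrot.density (fun v => W (i :: v)) n ω x)) (ℓ * x - (i : ℕ))
            = s.indicator (fun x => ENNReal.ofReal
              (Mandelbrot.density (fun v => W (i :: v)) n ω (ℓ * x - (i : ℕ)))) x := fun x => by
          have h4 : childMap i (ℓ * x - (i : ℕ)) = x := by
            rw [childMap, sub_add_cancel, mul_div_cancel_left₀ _ hℓ']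
          have h5 : (ℓ : ℝ) * x - (i : ℕ) ∈ childMap i ⁻¹' s ↔ x ∈ s := by
            rw [Set.mem_preimage, h4]
          by_cases hx : x ∈ s
          · rw [Set.indicator_of_mem (h5.2 hx), Set.indicator_of_mem hx]
          · rw [Set.indicator_of_notMem (mt h5.1 hx), Set.indicator_of_notMem hx]
        simp_rw [h3] at h2
        rw [h2, ← mul_assoc, ENNReal.mul_inv_cancel (by exact_mod_cast hℓ) (by finiteness), one_mul]
      · exact (hm i).comp (by fun_prop)
      · exact ((hm i).comp (by fun_prop)).const_mul _
    · exact fun i _ => (((hm i).comp (by fun_prop)).const_mul _).const_mul _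

theorem log_scale_ineq (hℓ : 2 ≤ ℓ) {c v : ℝ} {n : ℕ} (hn : 0 < n) (hv : 0 < v) :
    (ENNReal.ofReal v * scale ℓ c n ≤ 1 ↔ c ≤ Real.log v / Real.log ((ℓ : ℝ) ^ n)⁻¹) ∧
      (1 ≤ ENNReal.ofReal v * scale ℓ c n ↔ Real.log v / Real.log ((ℓ : ℝ) ^ n)⁻¹ ≤ c) := by
  have hℓ1 : (1 : ℝ) < ℓ := by exact_mod_cast hℓ
  have hL : 0 < n * Real.log ℓ := mul_pos (by exact_mod_cast hn) (Real.log_pos hℓ1)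
  have hp : 0 < v * (ℓ : ℝ) ^ (n * c) := by positivity
  have h1 : Real.log (v * (ℓ : ℝ) ^ (n * c)) = Real.log v + c * (n * Real.log ℓ) := by
    rw [Real.log_mul hv.ne' (by positivity), Real.log_rpow (by positivity)]
    ring
  rw [scale, ← ENNReal.ofReal_mul hv.le, Real.log_inv, Real.log_pow, div_neg, ENNReal.ofReal_le_one,
    ENNReal.one_le_ofReal, ← Real.log_nonpos_iff hp.le, ← Real.log_nonneg_iff hp, h1, le_neg,
    neg_le, le_div_iff₀ hL, div_le_iff₀ hL]
  constructor <;> constructor <;> intro h <;> linarith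

/-- Membership in the level set, from comparisons of the mass of the `ℓ`-adic cells with powers of
their length for exponents close to `β`. -/
theorem mem_levelSet (hℓ : 2 ≤ ℓ) {m : Measure ℝ} [IsFiniteMeasure m] {x β : ℝ}
    (hx : x ∈ Set.Ico (0 : ℝ) 1) (h0 : ∀ n, m (gridCell ℓ n x) ≠ 0)
    (hlo : ∀ k : ℕ, ∀ᶠ n in atTop, m (gridCell ℓ n x) * scale ℓ (β - 1 / (k + 1)) n ≤ 1)
    (hhi : ∀ k : ℕ, ∀ᶠ n in atTop, 1 ≤ m (gridCell ℓ n x) * scale ℓ (β + 1 / (k + 1)) n) :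
    x ∈ Mandelbrot.levelSet ℓ m β := by
  have hℓ0 : ℓ ≠ 0 := by omega
  have hgrid := fun n => adicIntervalAt_eq_gridCell hℓ0 n hx
  refine ⟨hx, fun n => by rw [hgrid]; exact h0 n, ?_⟩
  simp only [hgrid, volume_gridCell hℓ0]
  have hv : ∀ n, 0 < m.real (gridCell ℓ n x) := fun n =>
    ENNReal.toReal_pos (h0 n) (measure_ne_top _ _)
  have hvm : ∀ n, m (gridCell ℓ n x) = ENNReal.ofReal (m.real (gridCell ℓ n x)) := fun n =>
    (ofReal_measureReal).symm
  refine Metric.tendsto_nhds.2 fun ε hε => ?_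
  obtain ⟨k, hk⟩ := exists_nat_one_div_lt hε
  filter_upwards [hlo k, hhi k, eventually_gt_atTop 0] with n h1 h2 hn
  rw [hvm, (log_scale_ineq hℓ hn (hv n)).1] at h1
  rw [hvm, (log_scale_ineq hℓ hn (hv n)).2] at h2
  rw [Real.dist_eq, abs_lt]
  constructor <;> linarith

end

/-! ### Tilted weights -/

section

variable {ℓ : ℕ} {ν : Measure ℝ}

/-- The edge weight of the cascade tilted by the exponent `t`: for labels `x = log W`, it is
`W ^ t / E[W ^ t]`, divided by `ℓ`. -/
def tilt (ℓ : ℕ) (ν : Measure ℝ) (t x : ℝ) : ℝ≥0 :=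
  Real.toNNReal (Real.exp (t * x - (cgf id ν t + Real.log ℓ)))

theorem coe_tilt (t x : ℝ) : (tilt ℓ ν t x : ℝ≥0∞) =
    ENNReal.ofReal (Real.exp (t * x - (cgf id ν t + Real.log ℓ))) := rfl

theorem tilt_ne_zero (t x : ℝ) : tilt ℓ ν t x ≠ 0 := by
  simp [tilt, Real.exp_pos]

@[fun_prop]
theorem measurable_tilt (t : ℝ) : Measurable (tilt ℓ ν t) := by
  unfold tilt; fun_prop

/-- The logarithm of the growth rate, from one generation to the next, of the mean of the sum over
all cells of `N(I) (m(I) / |I| ^ c) ^ s`, where `N` and `m` are the cascades tilted by `q` and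
`t`. -/
def rate (ℓ : ℕ) (ν : Measure ℝ) (q t c s : ℝ) : ℝ :=
  s * Real.log ℓ * (c - 1) + cgf id ν (q + s * t) - cgf id ν q - s * cgf id ν t

theorem rate_zero (q t c : ℝ) : rate ℓ ν q t c 0 = 0 := by simp [rate]

theorem differentiableAt_cgf (hint : ∀ t, Integrable (fun x => Real.exp (t * x)) ν) (q : ℝ) :
    DifferentiableAt ℝ (cgf id ν) q := by
  have h : integrableExpSet id ν = Set.univ := Set.eq_univ_of_forall hint
  exact (analyticAt_cgf (by rw [h, interior_univ]; trivial)).differentiableAt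

theorem hasDerivAt_rate (hint : ∀ t, Integrable (fun x => Real.exp (t * x)) ν) (q t c : ℝ) :
    HasDerivAt (rate ℓ ν q t c)
      (Real.log ℓ * (c - 1) + t * deriv (cgf id ν) q - cgf id ν t) 0 := by
  have h1 : HasDerivAt (cgf id ν) (deriv (cgf id ν) q) (q + 0 * t) := by
    simpa using (differentiableAt_cgf hint q).hasDerivAt
  have h2 : HasDerivAt (fun s : ℝ => q + s * t) (1 * t) 0 :=
    ((hasDerivAt_id _).mul_const t).const_add q
  have h3 := h1.comp (0 : ℝ) h2
  have h4 : HasDerivAt (fun s : ℝ => s * Real.log ℓ * (c - 1)) (1 * Real.log ℓ * (c - 1)) 0 :=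
    ((hasDerivAt_id _).mul_const _).mul_const _
  have h5 : HasDerivAt (fun s : ℝ => s * cgf id ν t) (1 * cgf id ν t) 0 :=
    (hasDerivAt_id _).mul_const _
  exact (((h4.add h3).sub_const (cgf id ν q)).sub h5).congr_deriv (by ring)

theorem eventually_rate_neg_right (hint : ∀ t, Integrable (fun x => Real.exp (t * x)) ν)
    {q t c : ℝ} (h : Real.log ℓ * (c - 1) + t * deriv (cgf id ν) q - cgf id ν t < 0) :
    ∀ᶠ s in 𝓝[>] 0, rate ℓ ν q t c s < 0 := by
  have h1 := (hasDerivAt_iff_tendsto_slope.1 (hasDerivAt_rate (ℓ := ℓ) hint q t c)).mono_left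
    (nhdsWithin_mono 0 (fun s (hs : 0 < s) => hs.ne' : Set.Ioi (0 : ℝ) ⊆ {0}ᶜ))
  filter_upwards [h1.eventually_lt_const h, self_mem_nhdsWithin] with s h2 hs
  rw [slope_def_field, rate_zero, sub_zero, sub_zero, div_neg_iff] at h2
  rcases h2 with h2 | h2
  · exact absurd h2.2 (not_lt.2 (le_of_lt hs))
  · exact h2.1

theorem eventually_rate_neg_left (hint : ∀ t, Integrable (fun x => Real.exp (t * x)) ν)
    {q t c : ℝ} (h : 0 < Real.log ℓ * (c - 1) + t * deriv (cgf id ν) q - cgf id ν t) :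
    ∀ᶠ s in 𝓝[<] 0, rate ℓ ν q t c s < 0 := by
  have h1 := (hasDerivAt_iff_tendsto_slope.1 (hasDerivAt_rate (ℓ := ℓ) hint q t c)).mono_left
    (nhdsWithin_mono 0 (fun s (hs : s < 0) => hs.ne : Set.Iio (0 : ℝ) ⊆ {0}ᶜ))
  filter_upwards [h1.eventually_const_lt h, self_mem_nhdsWithin] with s h2 hs
  rw [slope_def_field, rate_zero, sub_zero, sub_zero, div_pos_iff] at h2
  rcases h2 with h2 | h2
  · exact absurd h2.2 (not_lt.2 (le_of_lt hs))
  · exact h2.1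

theorem tilt_mul_rpow (q t s x : ℝ) : (tilt ℓ ν q x : ℝ≥0∞) * (tilt ℓ ν t x : ℝ≥0∞) ^ s =
    ENNReal.ofReal (Real.exp ((q + s * t) * x -
      (cgf id ν q + s * cgf id ν t + (1 + s) * Real.log ℓ))) := by
  rw [coe_tilt, coe_tilt, ENNReal.ofReal_rpow_of_pos (Real.exp_pos _), ← Real.exp_mul,
    ← ENNReal.ofReal_mul (Real.exp_pos _).le, ← Real.exp_add]
  congr 2
  ring

variable [IsProbabilityMeasure ν]

theorem lintegral_ofReal_exp (hint : ∀ t, Integrable (fun x => Real.exp (t * x)) ν) (t b : ℝ) :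
    ∫⁻ x, ENNReal.ofReal (Real.exp (t * x - b)) ∂ν =
      ENNReal.ofReal (Real.exp (cgf id ν t - b)) := by
  have h : ∀ x, Real.exp (t * x - b) = Real.exp (t * x) * Real.exp (-b) := fun x => by
    rw [← Real.exp_add, sub_eq_add_neg]
  simp_rw [h]
  rw [← ofReal_integral_eq_lintegral_ofReal ((hint t).mul_const _)
    (ae_of_all _ fun x => by positivity), integral_mul_const, sub_eq_add_neg, Real.exp_add,
    exp_cgf (X := id) (hint t)]
  rfl

theorem natCast_eq_ofReal_exp_log (hℓ : ℓ ≠ 0) :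
    (ℓ : ℝ≥0∞) = ENNReal.ofReal (Real.exp (Real.log ℓ)) := by
  rw [Real.exp_log (by positivity), ENNReal.ofReal_natCast]

theorem mul_lintegral_tilt_mul_rpow (hℓ : ℓ ≠ 0)
    (hint : ∀ t, Integrable (fun x => Real.exp (t * x)) ν) (q t c s : ℝ) :
    ℓ * ENNReal.ofReal ((ℓ : ℝ) ^ (c * s)) *
        ∫⁻ x, (tilt ℓ ν q x : ℝ≥0∞) * (tilt ℓ ν t x : ℝ≥0∞) ^ s ∂ν
      = ENNReal.ofReal (Real.exp (rate ℓ ν q t c s)) := by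
  simp_rw [tilt_mul_rpow]
  rw [lintegral_ofReal_exp hint, natCast_eq_ofReal_exp_log hℓ,
    Real.rpow_def_of_pos (by positivity), ← ENNReal.ofReal_mul (Real.exp_pos _).le, ← Real.exp_add,
    ← ENNReal.ofReal_mul (Real.exp_pos _).le, ← Real.exp_add, rate]
  congr 2
  ring

theorem mul_lintegral_tilt (hℓ : ℓ ≠ 0) (hint : ∀ t, Integrable (fun x => Real.exp (t * x)) ν)
    (q : ℝ) : (ℓ : ℝ≥0∞) * ∫⁻ x, tilt ℓ ν q x ∂ν = 1 := by
  have h := mul_lintegral_tilt_mul_rpow hℓ hint q 0 0 0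
  simpa [rate] using h

theorem mul_lintegral_tilt_rpow_lt_one (hℓ : ℓ ≠ 0)
    (hint : ∀ t, Integrable (fun x => Real.exp (t * x)) ν) {q s : ℝ} (hs : rate ℓ ν q q 0 s < 0) :
    (ℓ : ℝ≥0∞) * ∫⁻ x, (tilt ℓ ν q x : ℝ≥0∞) ^ (1 + s) ∂ν < 1 := by
  have h := mul_lintegral_tilt_mul_rpow hℓ hint q q 0 s
  have h1 : ∀ x, (tilt ℓ ν q x : ℝ≥0∞) ^ (1 + s)
      = (tilt ℓ ν q x : ℝ≥0∞) * (tilt ℓ ν q x : ℝ≥0∞) ^ s := fun x => by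
    rw [ENNReal.rpow_add _ _ (by exact_mod_cast tilt_ne_zero q x) ENNReal.coe_ne_top,
      ENNReal.rpow_one]
  rw [zero_mul, Real.rpow_zero, ENNReal.ofReal_one, mul_one] at h
  simp_rw [h1]
  rw [h, ENNReal.ofReal_lt_one, Real.exp_lt_one_iff]
  exact hs

theorem lintegral_tilt_inv_ne_top (hint : ∀ t, Integrable (fun x => Real.exp (t * x)) ν) (q : ℝ) :
    ∫⁻ x, (tilt ℓ ν q x : ℝ≥0∞)⁻¹ ∂ν ≠ ∞ := by
  have h : ∀ x, (tilt ℓ ν q x : ℝ≥0∞)⁻¹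
      = ENNReal.ofReal (Real.exp (-q * x - -(cgf id ν q + Real.log ℓ))) := fun x => by
    rw [coe_tilt, ← ENNReal.ofReal_inv_of_pos (Real.exp_pos _), ← Real.exp_neg]
    congr 2
    ring
  simp_rw [h]
  rw [lintegral_ofReal_exp hint]
  exact ENNReal.ofReal_ne_top

/-! ### Sums over cells -/

theorem pathWeight_mul_rpow {f g : ℝ → ℝ≥0} (hg0 : ∀ x, g x ≠ 0) (s : ℝ) (w : List (Fin ℓ))
    (a : Tree ℓ) : (pathWeight (fun x => f x * g x ^ s) w a : ℝ≥0∞)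
      = pathWeight f w a * (pathWeight g w a : ℝ≥0∞) ^ s := by
  induction w generalizing a with
  | nil => simp [pathWeight]
  | cons i w ih =>
    simp only [pathWeight, ENNReal.coe_mul, ih]
    rw [ENNReal.coe_mul_rpow, ENNReal.coe_rpow_of_ne_zero (hg0 _)]
    ring

theorem pathWeight_ne_zero {g : ℝ → ℝ≥0} (hg0 : ∀ x, g x ≠ 0) (w : List (Fin ℓ)) (a : Tree ℓ) :
    pathWeight g w a ≠ 0 := by
  induction w generalizing a with
  | nil => exact one_ne_zero
  | cons i w ih => exact mul_ne_zero (hg0 _) (ih _)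

theorem scale_rpow (hℓ : ℓ ≠ 0) (c s : ℝ) (n : ℕ) :
    scale ℓ c n ^ s = ENNReal.ofReal ((ℓ : ℝ) ^ (c * s)) ^ n := by
  rw [scale, ENNReal.ofReal_rpow_of_pos (by positivity), ← ENNReal.ofReal_pow (by positivity),
    ← Real.rpow_mul (by positivity), ← Real.rpow_natCast, ← Real.rpow_mul (by positivity)]
  congr 2
  ring

/-- The mean of the sum over the cells of the generation `n` is a constant times the `n`-th power
of `exp (rate)`, so that the sum over all cells is almost surely finite when the rate is
negative. -/
theorem ae_tsum_cellMass_ne_top (hℓ : ℓ ≠ 0)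
    (hint : ∀ t, Integrable (fun x => Real.exp (t * x)) ν) {q t c s : ℝ}
    (hpos : ∀ᵐ a ∂treeLaw ℓ ν, limMass (tilt ℓ ν t) a ≠ 0)
    (hK : ∫⁻ a, limMass (tilt ℓ ν q) a * limMass (tilt ℓ ν t) a ^ s ∂treeLaw ℓ ν ≠ ∞)
    (hrate : rate ℓ ν q t c s < 0) :
    ∀ᵐ a ∂treeLaw ℓ ν, ∑' n : ℕ, ∑ ε : Fin n → Fin ℓ, cellMass (tilt ℓ ν q) (List.ofFn ε) a *
      (cellMass (tilt ℓ ν t) (List.ofFn ε) a * scale ℓ c n) ^ s ≠ ∞ := by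
  set G : ℝ → ℝ≥0 := fun x => tilt ℓ ν q x * tilt ℓ ν t x ^ s with hG
  have hGm : Measurable G := (measurable_tilt q).mul ((measurable_tilt t).pow_const s)
  have hFm : Measurable fun a : Tree ℓ =>
      limMass (tilt ℓ ν q) a * limMass (tilt ℓ ν t) a ^ s :=
    (measurable_limMass (measurable_tilt q)).mul
      ((measurable_limMass (measurable_tilt t)).pow_const s)
  have hGint : ∫⁻ x, G x ∂ν = ∫⁻ x, (tilt ℓ ν q x : ℝ≥0∞) * (tilt ℓ ν t x : ℝ≥0∞) ^ s ∂ν := by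
    refine lintegral_congr fun x => ?_
    rw [hG, ENNReal.coe_mul, ENNReal.coe_rpow_of_ne_zero (tilt_ne_zero t x)]
  set K := ∫⁻ a, limMass (tilt ℓ ν q) a * limMass (tilt ℓ ν t) a ^ s ∂treeLaw ℓ ν
  set H : ℕ → Tree ℓ → ℝ≥0∞ := fun n a => ∑ ε : Fin n → Fin ℓ, scale ℓ c n ^ s *
    (pathWeight G (List.ofFn ε) a * (limMass (tilt ℓ ν q) (subTreeAt (List.ofFn ε) a) *
      limMass (tilt ℓ ν t) (subTreeAt (List.ofFn ε) a) ^ s)) with hH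
  have hterm : ∀ w : List (Fin ℓ), Measurable fun a : Tree ℓ =>
      pathWeight G w a * (limMass (tilt ℓ ν q) (subTreeAt w a) *
        limMass (tilt ℓ ν t) (subTreeAt w a) ^ s) := fun w =>
    (measurable_pathWeight hGm w).coe_nnreal_ennreal.mul (hFm.comp (measurable_subTreeAt w))
  have hHm : ∀ n, Measurable (H n) := fun n =>
    Finset.measurable_fun_sum _ fun ε _ => (hterm _).const_mul _
  have hHint : ∀ n, ∫⁻ a, H n a ∂treeLaw ℓ ν
      = ENNReal.ofReal (Real.exp (rate ℓ ν q t c s)) ^ n * K := by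
    intro n
    rw [hH, lintegral_finsetSum _ fun ε _ => (hterm _).const_mul _]
    have : ∀ ε : Fin n → Fin ℓ, ∫⁻ a, scale ℓ c n ^ s *
        (pathWeight G (List.ofFn ε) a * (limMass (tilt ℓ ν q) (subTreeAt (List.ofFn ε) a) *
          limMass (tilt ℓ ν t) (subTreeAt (List.ofFn ε) a) ^ s)) ∂treeLaw ℓ ν
        = ENNReal.ofReal ((ℓ : ℝ) ^ (c * s)) ^ n * ((∫⁻ x, G x ∂ν) ^ n * K) := fun ε => by
      rw [lintegral_const_mul _ (hterm _), scale_rpow hℓ,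
        lintegral_pathWeight_mul hGm _ hFm, List.length_ofFn]
    simp_rw [this]
    rw [Finset.sum_const, Finset.card_univ, Fintype.card_fun, Fintype.card_fin, Fintype.card_fin,
      nsmul_eq_mul, ← mul_lintegral_tilt_mul_rpow hℓ hint, ← hGint, mul_pow, mul_pow]
    push_cast
    ring
  have hfin : ∫⁻ a, ∑' n, H n a ∂treeLaw ℓ ν ≠ ∞ := by
    rw [lintegral_tsum fun n => (hHm n).aemeasurable]
    simp_rw [hHint]
    rw [ENNReal.tsum_mul_right, ENNReal.tsum_geometric]
    refine ENNReal.mul_ne_top (ENNReal.inv_ne_top.2 (tsub_pos_of_lt ?_).ne') hK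
    rw [ENNReal.ofReal_lt_one, Real.exp_lt_one_iff]
    exact hrate
  filter_upwards [ae_lt_top (Measurable.tsum hHm) hfin, ae_forall_subTreeAt hpos] with a ha hpos
  convert ha.ne using 3 with n
  refine Finset.sum_congr rfl fun ε _ => ?_
  have h1 : (pathWeight (tilt ℓ ν t) (List.ofFn ε) a : ℝ≥0∞) ≠ 0 := by
    exact_mod_cast pathWeight_ne_zero (tilt_ne_zero t) _ a
  rw [cellMass, cellMass,
    ENNReal.mul_rpow_of_ne_zero (mul_ne_zero h1 (hpos _)) (scale_ne_zero hℓ c n),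
    ENNReal.mul_rpow_of_ne_zero h1 (hpos _), pathWeight_mul_rpow (tilt_ne_zero t)]
  ring

end

/-! ### The dimension of the level sets of the tree cascade -/

section

variable {ℓ : ℕ} {ν : Measure ℝ} [IsProbabilityMeasure ν]

theorem le_one_of_rpow_le_one {y : ℝ≥0∞} {s : ℝ} (hs : 0 < s) (h : y ^ s ≤ 1) : y ≤ 1 := by
  by_contra hy
  exact absurd h (not_le.2 (ENNReal.one_lt_rpow (not_le.1 hy) hs))

theorem one_le_of_rpow_le_one {y : ℝ≥0∞} {s : ℝ} (hs : s < 0) (h : y ^ s ≤ 1) : 1 ≤ y := by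
  by_contra hy
  have h1 : y ^ (-s) < 1 := ENNReal.rpow_lt_one (not_le.1 hy) (neg_pos.2 hs)
  rw [← neg_neg s, ENNReal.rpow_neg, ENNReal.inv_le_one] at h
  exact absurd h (not_le.2 h1)

/-- The tilted cascade `N` is carried by the level set, and its cells have masses at most the power
`c` of their lengths. Both facts follow from the finiteness of the sums over cells, for
exponents `s` that make the rate negative. -/
theorem ae_ofReal_le_dimH_levelSet (hℓ : 2 ≤ ℓ)
    (hint : ∀ t, Integrable (fun x => Real.exp (t * x)) ν)
    (hnd : ¬ ∀ᵐ a ∂treeLaw ℓ ν, limMass (tilt ℓ ν 1) a = 0) (hone : cgf id ν 1 = 0)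
    {q β c : ℝ} (hβ : Real.log ℓ * (1 - β) = deriv (cgf id ν) q) (hc0 : 0 < c)
    (hc : Real.log ℓ * (c - 1) + q * deriv (cgf id ν) q - cgf id ν q < 0) :
    ∀ᵐ a ∂treeLaw ℓ ν, ENNReal.ofReal c ≤
      dimH (Mandelbrot.levelSet ℓ (limMeasure (tilt ℓ ν 1) a : Measure ℝ) β) := by
  have hℓ0 : ℓ ≠ 0 := by omega
  have hL : 0 < Real.log ℓ := Real.log_pos (by exact_mod_cast hℓ)
  have hcrit : ∀ t, (ℓ : ℝ≥0∞) * ∫⁻ x, tilt ℓ ν t x ∂ν = 1 := mul_lintegral_tilt hℓ0 hint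
  -- The tilted cascade is bounded in `L^(1 + s)` for some `s > 0`: as `c > 0`, the derivative of
  -- the rate at `s = 0` is also negative for the exponent `0` in place of `c`.
  obtain ⟨s, hs, hs0, hs1⟩ : ∃ s, rate ℓ ν q q 0 s < 0 ∧ 0 < s ∧ s < 1 := by
    have h := eventually_rate_neg_right (ℓ := ℓ) hint (q := q) (t := q) (c := 0) (by nlinarith)
    have h1 : ∀ᶠ s : ℝ in 𝓝[>] 0, s < 1 := nhdsWithin_le_nhds (eventually_lt_nhds one_pos)
    obtain ⟨s, ⟨h2, h4⟩, h3⟩ := ((h.and h1).and self_mem_nhdsWithin).exists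
    exact ⟨s, h2, h3, h4⟩
  have hgp := mul_lintegral_tilt_rpow_lt_one hℓ0 hint hs
  have hLp := lintegral_limMass_rpow_ne_top (measurable_tilt q) (hcrit q) (by linarith)
    (by linarith) hgp
  have hpos1 := ae_limMass_ne_zero hℓ (measurable_tilt 1) (tilt_ne_zero 1) hnd
  have hposq := ae_limMass_ne_zero hℓ (measurable_tilt q) (tilt_ne_zero q)
    (not_ae_limMass_eq_zero (measurable_tilt q) (hcrit q) (by linarith) (by linarith) hgp)
  have hmixed : ∀ t, (∀ᵐ a ∂treeLaw ℓ ν, limMass (tilt ℓ ν t) a ≠ 0) →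
      ∃ s₀ : ℝ, 0 < s₀ ∧ ∀ s : ℝ, |s| < s₀ →
        ∫⁻ a, limMass (tilt ℓ ν q) a * limMass (tilt ℓ ν t) a ^ s ∂treeLaw ℓ ν ≠ ∞ := by
    intro t ht
    obtain ⟨r, hr, hZr⟩ := exists_lintegral_limMass_rpow_neg_ne_top hℓ (measurable_tilt t)
      (lintegral_tilt_inv_ne_top hint t) ht
    exact exists_forall_lintegral_mul_rpow_ne_top (measurable_limMass (measurable_tilt q))
      (measurable_limMass (measurable_tilt t)) (by linarith) hr hLp
      (ne_top_of_le_ne_top ENNReal.one_ne_top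
        (lintegral_limMass_le_one (measurable_tilt t) (hcrit t))) hZr
  have hright : ∀ t c, (∀ᵐ a ∂treeLaw ℓ ν, limMass (tilt ℓ ν t) a ≠ 0) →
      Real.log ℓ * (c - 1) + t * deriv (cgf id ν) q - cgf id ν t < 0 → ∃ s : ℝ, 0 < s ∧
        ∀ᵐ a ∂treeLaw ℓ ν, ∑' n : ℕ, ∑ ε : Fin n → Fin ℓ,
          cellMass (tilt ℓ ν q) (List.ofFn ε) a *
            (cellMass (tilt ℓ ν t) (List.ofFn ε) a * scale ℓ c n) ^ s ≠ ∞ := by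
    intro t c ht hslope
    obtain ⟨s₀, hs₀, hK⟩ := hmixed t ht
    have h1 : ∀ᶠ s : ℝ in 𝓝[>] 0, s < s₀ := nhdsWithin_le_nhds (eventually_lt_nhds hs₀)
    obtain ⟨s, ⟨h2, h4⟩, h3⟩ := (((eventually_rate_neg_right (ℓ := ℓ) hint hslope).and
      h1).and self_mem_nhdsWithin).exists
    have h3 : 0 < s := h3
    exact ⟨s, h3, ae_tsum_cellMass_ne_top hℓ0 hint ht (hK s (by rwa [abs_of_pos h3])) h2⟩
  have hleft : ∀ t c, (∀ᵐ a ∂treeLaw ℓ ν, limMass (tilt ℓ ν t) a ≠ 0) →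
      0 < Real.log ℓ * (c - 1) + t * deriv (cgf id ν) q - cgf id ν t → ∃ s : ℝ, s < 0 ∧
        ∀ᵐ a ∂treeLaw ℓ ν, ∑' n : ℕ, ∑ ε : Fin n → Fin ℓ,
          cellMass (tilt ℓ ν q) (List.ofFn ε) a *
            (cellMass (tilt ℓ ν t) (List.ofFn ε) a * scale ℓ c n) ^ s ≠ ∞ := by
    intro t c ht hslope
    obtain ⟨s₀, hs₀, hK⟩ := hmixed t ht
    have h1 : ∀ᶠ s : ℝ in 𝓝[<] 0, -s₀ < s :=
      nhdsWithin_le_nhds (eventually_gt_nhds (neg_neg_iff_pos.2 hs₀))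
    obtain ⟨s, ⟨h2, h4⟩, h3⟩ := (((eventually_rate_neg_left (ℓ := ℓ) hint hslope).and
      h1).and self_mem_nhdsWithin).exists
    have h3 : s < 0 := h3
    exact ⟨s, h3, ae_tsum_cellMass_ne_top hℓ0 hint ht
      (hK s (by rw [abs_of_neg h3]; linarith)) h2⟩
  obtain ⟨sN, hsN, hsumN⟩ := hright q c hposq hc
  -- For the cascade itself, `t = 1`, the derivative of the rate at `s = 0` has the sign of the
  -- difference between the exponent and `β`.
  have hlo : ∀ k : ℕ, _ := fun k => hright 1 (β - 1 / (k + 1)) hpos1 (by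
    have : 0 < Real.log ℓ * (1 / ((k : ℝ) + 1)) := by positivity
    rw [hone]; linarith)
  have hhi : ∀ k : ℕ, _ := fun k => hleft 1 (β + 1 / (k + 1)) hpos1 (by
    have : 0 < Real.log ℓ * (1 / ((k : ℝ) + 1)) := by positivity
    rw [hone]; linarith)
  choose slo hslo hsumlo using hlo
  choose shi hshi hsumhi using hhi
  filter_upwards [hsumN, ae_all_iff.2 hsumlo, ae_all_iff.2 hsumhi, hposq,
    ae_forall_subTreeAt hpos1, ae_convergent (measurable_tilt 1) (hcrit 1),
    ae_convergent (measurable_tilt q) (hcrit q), ae_noEndMass hℓ (measurable_tilt 1) (hcrit 1),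
    ae_noEndMass hℓ (measurable_tilt q) (hcrit q)] with a hN hlo hhi hq0 h10 hC1 hCq hE1 hEq
  set m : Measure ℝ := (limMeasure (tilt ℓ ν 1) a : Measure ℝ)
  set N : Measure ℝ := (limMeasure (tilt ℓ ν q) a : Measure ℝ)
  have hNsupp : N (Set.Ico 0 1)ᶜ = 0 := limMeasure_compl_Ico hℓ hCq hEq
  have hmcell : ∀ w, m (cell w) = cellMass (tilt ℓ ν 1) w a := limMeasure_cell hℓ hC1 hE1
  have hNcell : ∀ w, N (cell w) = cellMass (tilt ℓ ν q) w a := limMeasure_cell hℓ hCq hEq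
  simp only [← hmcell, ← hNcell] at hN hlo hhi
  have hgridN := ae_eventually_rpow_le_one hℓ0 hNsupp N c sN hN
  have hgridlo := ae_all_iff.2 fun k => ae_eventually_rpow_le_one hℓ0 hNsupp m _ (slo k) (hlo k)
  have hgridhi := ae_all_iff.2 fun k => ae_eventually_rpow_le_one hℓ0 hNsupp m _ (shi k) (hhi k)
  refine ofReal_le_dimH hℓ (N := N) ?_ hc0 ?_ ?_
  · rw [hCq.limMeasure_univ hℓ]
    exact hq0
  · filter_upwards [measure_eq_zero_iff_ae_notMem.1 hNsupp, hgridlo, hgridhi] with x hx h1 h2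
    rw [Set.mem_compl_iff, not_not] at hx
    refine mem_levelSet hℓ hx (fun n => ?_)
      (fun k => (h1 k).mono fun n hn => le_one_of_rpow_le_one (hslo k) hn)
      (fun k => (h2 k).mono fun n hn => one_le_of_rpow_le_one (hshi k) hn)
    obtain ⟨ε, hε⟩ := exists_mem_cell hℓ0 n hx
    rw [← cell_eq_gridCell List.length_ofFn hε, hmcell, cellMass]
    refine mul_ne_zero ?_ (h10 _)
    exact_mod_cast pathWeight_ne_zero (tilt_ne_zero 1) _ a
  · filter_upwards [hgridN] with x hx
    exact hx.mono fun n hn => le_one_of_rpow_le_one hsN hn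

end

/-! ### From the weights to the tree of labels -/

/-- The limiting case of `ae_ofReal_le_dimH_levelSet`, along a sequence of exponents that increases
to `D`. -/
theorem ae_ofReal_le_dimH_levelSet_of_pos {ℓ : ℕ} {ν : Measure ℝ} [IsProbabilityMeasure ν]
    (hℓ : 2 ≤ ℓ) (hint : ∀ t, Integrable (fun x => Real.exp (t * x)) ν)
    (hnd : ¬ ∀ᵐ a ∂treeLaw ℓ ν, limMass (tilt ℓ ν 1) a = 0) (hone : cgf id ν 1 = 0) {q β D : ℝ}
    (hβ : Real.log ℓ * (1 - β) = deriv (cgf id ν) q) (hD0 : 0 < D)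
    (hD : Real.log ℓ * (D - 1) + q * deriv (cgf id ν) q - cgf id ν q = 0) :
    ∀ᵐ a ∂treeLaw ℓ ν, ENNReal.ofReal D ≤
      dimH (Mandelbrot.levelSet ℓ (limMeasure (tilt ℓ ν 1) a : Measure ℝ) β) := by
  have hL : 0 < Real.log ℓ := Real.log_pos (by exact_mod_cast hℓ)
  obtain ⟨u, -, hu, hlim⟩ := exists_seq_strictMono_tendsto' hD0
  have h : ∀ n, ∀ᵐ a ∂treeLaw ℓ ν, ENNReal.ofReal (u n) ≤
      dimH (Mandelbrot.levelSet ℓ (limMeasure (tilt ℓ ν 1) a : Measure ℝ) β) := fun n =>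
    ae_ofReal_le_dimH_levelSet hℓ hint hnd hone hβ (hu n).1
      (by nlinarith [mul_lt_mul_of_pos_left (hu n).2 hL])
  filter_upwards [ae_all_iff.2 h] with a ha
  exact le_of_tendsto' (ENNReal.tendsto_ofReal hlim) ha

/-- The law of the logarithms of the weights on the edges of the tree. The weight of the empty
word plays no role in the cascade. -/
theorem map_log_eq_treeLaw {ℓ : ℕ} {Ω Ω₀ : Type*} [MeasurableSpace Ω] [MeasurableSpace Ω₀]
    {P : Measure Ω} [IsProbabilityMeasure P] {P₀ : Measure Ω₀} {W₀ : Ω₀ → ℝ}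
    {W : List (Fin ℓ) → Ω → ℝ} (hW : ∀ w, Measurable (W w))
    (hlaw : ∀ w, IdentDistrib (W w) W₀ P P₀) (hind : iIndepFun W P) :
    P.map (fun ω (p : Fin ℓ × List (Fin ℓ)) => Real.log (W (p.1 :: p.2) ω)) =
      treeLaw ℓ (P₀.map fun ω => Real.log (W₀ ω)) := by
  have hinj : Function.Injective fun p : Fin ℓ × List (Fin ℓ) => p.1 :: p.2 := by
    rintro ⟨i, v⟩ ⟨j, w⟩ h
    simpa using h
  have h := (hind.precomp hinj).comp (fun _ => Real.log) fun _ => Real.measurable_log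
  refine (h.map_fun_eq_infinitePi_map fun p => Real.measurable_log.comp (hW _)).trans ?_
  exact congrArg Measure.infinitePi
    (funext fun p => ((hlaw (p.1 :: p.2)).comp Real.measurable_log).map_eq)

theorem mgf_map_log {Ω₀ : Type*} [MeasurableSpace Ω₀] {P₀ : Measure Ω₀} {W₀ : Ω₀ → ℝ}
    (hW : Measurable W₀) (hpos : ∀ᵐ ω ∂P₀, 0 < W₀ ω) (t : ℝ) :
    mgf id (P₀.map fun ω => Real.log (W₀ ω)) t = ∫ ω, W₀ ω ^ t ∂P₀ := by
  have hm : Measurable fun ω => Real.log (W₀ ω) := Real.measurable_log.comp hW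
  rw [mgf, integral_map hm.aemeasurable (by fun_prop)]
  refine integral_congr_ae (hpos.mono fun ω h => ?_)
  simp only [id]
  rw [Real.rpow_def_of_pos h, mul_comm]

theorem integrable_exp_mul_map_log {Ω₀ : Type*} [MeasurableSpace Ω₀] {P₀ : Measure Ω₀}
    {W₀ : Ω₀ → ℝ} (hW : Measurable W₀) (hpos : ∀ᵐ ω ∂P₀, 0 < W₀ ω) {t : ℝ}
    (h : Integrable (fun ω => W₀ ω ^ t) P₀) :
    Integrable (fun x => Real.exp (t * x)) (P₀.map fun ω => Real.log (W₀ ω)) := by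
  have hm : Measurable fun ω => Real.log (W₀ ω) := Real.measurable_log.comp hW
  rw [integrable_map_measure (by fun_prop) hm.aemeasurable]
  refine h.congr (hpos.mono fun ω h => ?_)
  simp only [Function.comp]
  rw [Real.rpow_def_of_pos h, mul_comm]

theorem structureFn_eq_cgf {ℓ : ℕ} {Ω₀ : Type*} [MeasurableSpace Ω₀] {P₀ : Measure Ω₀}
    {W₀ : Ω₀ → ℝ} (hW : Measurable W₀) (hpos : ∀ᵐ ω ∂P₀, 0 < W₀ ω) :
    Mandelbrot.structureFn ℓ P₀ W₀ = fun t =>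
      cgf id (P₀.map fun ω => Real.log (W₀ ω)) t / Real.log ℓ - (t - 1) := by
  funext t
  rw [Mandelbrot.structureFn, cgf, mgf_map_log hW hpos, Real.logb]

/-- With normalized weights, the cascade tilted by the exponent `1` is the original one. -/
theorem natCast_mul_tilt_one_log {ℓ : ℕ} (hℓ : ℓ ≠ 0) {ν : Measure ℝ} (hone : cgf id ν 1 = 0)
    {x : ℝ} (hx : 0 < x) : (ℓ : ℝ) * tilt ℓ ν 1 (Real.log x) = x := by
  have hℓ' : (0 : ℝ) < ℓ := by exact_mod_cast Nat.pos_of_ne_zero hℓ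
  rw [tilt, Real.coe_toNNReal _ (Real.exp_pos _).le, hone, one_mul, zero_add, Real.exp_sub,
    Real.exp_log hx, Real.exp_log hℓ', mul_div_cancel₀ _ hℓ'.ne']

end CascadeTree

end

open CascadeTree in
theorem mainTheorem6 {ℓ : ℕ} (hℓ : 2 ≤ ℓ)
    {Ω₀ : Type*} [MeasurableSpace Ω₀] (P₀ : Measure Ω₀) [IsProbabilityMeasure P₀]
    (W₀ : Ω₀ → ℝ) (hW₀_meas : Measurable W₀) (hW₀_nonneg : ∀ᵐ ω ∂P₀, 0 ≤ W₀ ω)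
    (hW₀_mean : ∫ ω, W₀ ω ∂P₀ = 1)
    (hW₀_zero : P₀ {ω | W₀ ω = 0} = 0)
    (hW₀_moments : ∀ q : ℝ, Integrable (fun ω => W₀ ω ^ q) P₀)
    {Ω : Type*} [MeasurableSpace Ω] (P : Measure Ω) [IsProbabilityMeasure P]
    (W : List (Fin ℓ) → Ω → ℝ) (hW_meas : ∀ w, Measurable (W w))
    (hW_law : ∀ w, IdentDistrib (W w) W₀ P P₀) (hW_indep : iIndepFun W P)
    (h_nondeg : 0 < P {ω | Mandelbrot.cascade W ω (Set.Icc 0 1) ≠ 0})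
    (q : ℝ) (hq : q ∈ Mandelbrot.qInterval (Mandelbrot.structureFn ℓ P₀ W₀))
    (β : ℝ) (hβ : β = -deriv (Mandelbrot.structureFn ℓ P₀ W₀) q) :
    DifferentiableAt ℝ (Mandelbrot.structureFn ℓ P₀ W₀) q ∧
    ∀ᵐ ω ∂P,
      Tendsto (fun n => Mandelbrot.approx W n ω) atTop (𝓝 (Mandelbrot.cascade W ω)) ∧
      Mandelbrot.legendre (Mandelbrot.structureFn ℓ P₀ W₀) β ≤
        ((dimH (Mandelbrot.levelSet ℓ (Mandelbrot.cascade W ω : Measure ℝ) β) : ENNReal) : EReal) := by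
  have hL : 0 < Real.log ℓ := Real.log_pos (by exact_mod_cast hℓ)
  have hℓ0 : ℓ ≠ 0 := by omega
  have hpos : ∀ᵐ ω ∂P₀, 0 < W₀ ω := by
    have h0 : ∀ᵐ ω ∂P₀, W₀ ω ≠ 0 := by rw [ae_iff]; simpa using hW₀_zero
    filter_upwards [hW₀_nonneg, h0] with ω h1 h2 using lt_of_le_of_ne h1 (Ne.symm h2)
  set ν : Measure ℝ := P₀.map fun ω => Real.log (W₀ ω) with hν
  have : IsProbabilityMeasure ν :=
    Measure.isProbabilityMeasure_map (Real.measurable_log.comp hW₀_meas).aemeasurable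
  have hint : ∀ t, Integrable (fun x => Real.exp (t * x)) ν := fun t =>
    integrable_exp_mul_map_log hW₀_meas hpos (hW₀_moments t)
  have hone : cgf id ν 1 = 0 := by
    rw [cgf, mgf_map_log hW₀_meas hpos]
    simp [hW₀_mean]
  -- The structure function is an affine transform of the cumulant generating function of `log W`.
  have hτ : Mandelbrot.structureFn ℓ P₀ W₀ = fun t => cgf id ν t / Real.log ℓ - (t - 1) :=
    structureFn_eq_cgf hW₀_meas hpos
  have hder : HasDerivAt (Mandelbrot.structureFn ℓ P₀ W₀)
      (deriv (cgf id ν) q / Real.log ℓ - 1) q := by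
    rw [hτ]
    exact ((differentiableAt_cgf hint q).hasDerivAt.div_const _).sub
      ((hasDerivAt_id q).sub_const 1)
  refine ⟨hder.differentiableAt, ?_⟩
  have hβ' : Real.log ℓ * (1 - β) = deriv (cgf id ν) q := by
    rw [hβ, hder.deriv]; field_simp; ring
  set D : ℝ := q * β + Mandelbrot.structureFn ℓ P₀ W₀ q with hDdef
  have hlegD : Mandelbrot.legendre (Mandelbrot.structureFn ℓ P₀ W₀) β ≤ (D : EReal) :=
    iInf_le (fun t : ℝ => ((t * β + Mandelbrot.structureFn ℓ P₀ W₀ t : ℝ) : EReal)) q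
  have hD0 : 0 < D := by
    have h : 0 < Mandelbrot.legendre (Mandelbrot.structureFn ℓ P₀ W₀) β := hβ ▸ hq
    exact_mod_cast h.trans_le hlegD
  have hD : Real.log ℓ * (D - 1) + q * deriv (cgf id ν) q - cgf id ν q = 0 := by
    rw [hDdef, hτ, ← hβ']; field_simp; ring
  -- The labels of the tree: the logarithms of the weights of the nonempty words.
  set T : Ω → Tree ℓ := fun ω p => Real.log (W (p.1 :: p.2) ω) with hT
  have hTm : Measurable T := measurable_pi_lambda _ fun p => Real.measurable_log.comp (hW_meas _)
  have hmap : P.map T = treeLaw ℓ ν := map_log_eq_treeLaw hW_meas hW_law hW_indep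
  have transfer : ∀ {p : Tree ℓ → Prop}, (∀ᵐ a ∂treeLaw ℓ ν, p a) → ∀ᵐ ω ∂P, p (T ω) :=
    fun h => ae_of_ae_map hTm.aemeasurable (hmap ▸ h)
  have hWpos : ∀ᵐ ω ∂P, ∀ w, 0 < W w ω :=
    ae_all_iff.2 fun w => (hW_law w).symm.ae_snd measurableSet_Ioi hpos
  have happrox : ∀ᵐ ω ∂P, ∀ n, Mandelbrot.approx W n ω = genMeasure (tilt ℓ ν 1) n (T ω) := by
    filter_upwards [hWpos] with ω hω n
    exact approx_eq_genMeasure hℓ0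
      (fun i v => (natCast_mul_tilt_one_log hℓ0 hone (hω (i :: v))).symm) n
  have hcascade : ∀ᵐ ω ∂P, Mandelbrot.cascade W ω = limMeasure (tilt ℓ ν 1) (T ω) := by
    filter_upwards [happrox] with ω hω
    rw [Mandelbrot.cascade, limMeasure, funext hω]
  have hconv := transfer
    (ae_convergent (measurable_tilt (ℓ := ℓ) (ν := ν) 1) (mul_lintegral_tilt hℓ0 hint 1))
  have hnd : ¬ ∀ᵐ a ∂treeLaw ℓ ν, limMass (tilt ℓ ν 1) a = 0 := by
    intro h
    refine h_nondeg.ne' ?_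
    rw [← compl_mem_ae_iff]
    filter_upwards [transfer h, hconv, hcascade] with ω h0 hc hm
    have h1 : (limMeasure (tilt ℓ ν 1) (T ω) : Measure ℝ) (Set.Icc 0 1) = 0 :=
      measure_mono_null (Set.subset_univ _) ((hc.limMeasure_univ hℓ).trans h0)
    rw [Set.mem_compl_iff, Set.mem_ofPred_eq, not_not, hm]
    exact (FiniteMeasure.null_iff_toMeasure_null _ _).2 h1
  filter_upwards [happrox, hcascade, hconv,
    transfer (ae_ofReal_le_dimH_levelSet_of_pos hℓ hint hnd hone hβ' hD0 hD)] with ω ha hm hc hd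
  refine ⟨?_, hlegD.trans ?_⟩
  · rw [hm, funext ha]
    exact hc.tendsto_genMeasure hℓ
  · rw [hm, ← max_eq_left hD0.le, ← EReal.coe_ennreal_ofReal]
    exact EReal.coe_ennreal_le_coe_ennreal_iff.2 hd
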